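/- Let $\mathbb K$ be a field and let $G$ be a finite simple graph with vertex set $V(G)=\{x_1,\dots,x_n\}$ and edge set $E(G)$. Let $S=\mathbb K[x_1,\dots,x_n]$ with its standard grading, and let $I(G)=(x_ix_j : x_ix_j\in E(G))\subseteq S$ be the edge ideal of $G$. For an ideal $I$ of $S$ and an integer $s\ge 1$, let $$I^{(s)}=\bigcap_{\mathfrak p\in \mathrm{Min}(I)}\mathrm{Ker}\big(S\to (S/I^s)_{\mathfrak p}\big)$$ be its $s$-th symbolic power, where $\mathrm{Min}(I)$ is the set of minimal primes of $I$. For a finitely generated graded $S$-module $M$ with minimal graded free resolution $$\cdots\to\bigoplus_j S(-j)^{\beta_{1,j}(M)}\to\bigoplus_j S(-j)^{\beta_{0,j}(M)}\to M\to 0,$$ let $\mathrm{reg}(M)=\max\{j-i : \beta_{i,j}(M)\ne 0\}$ be its Castelnuovo–Mumford regularity (with $\mathrm{reg}(0)=-\infty$). Then for every integer $s\ge 1$, $$\mathrm{reg}\big(I(G)^{(s+1)}\big)\le\max\Big\{\mathrm{reg}(I(G))+2s,\ \mathrm{reg}\big(I(G)^{(s+1)}+I(G)^s\big)\Big\}.$$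 -/

import Mathlib

noncomputable section

/-! Castelnuovo-Mumford regularity of finitely generated graded modules over the standard graded
polynomial ring `S = K[x_v : v ∈ V]`, with `V` finite. -/

/-- The degree `j` component `S_j` of the standard grading of `S`, for `j : ℤ`
(so it is zero for `j < 0`). -/
def polyComponent (K V : Type*) [Field K] (j : ℤ) : Submodule K (MvPolynomial V K) :=
  MvPolynomial.restrictSupport K {m : V →₀ ℕ | (m.degree : ℤ) = j}

/-- The degree `j` component of the graded free module `⨁ a, S(-e a)`: in the summand `S(-e a)`
the degree `j` component is `S_{j - e a}`, and the basis vector number `a` has degree `e a`. -/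
def freeComponent (K V : Type*) [Field K] {r : ℕ} (e : Fin r → ℤ) (j : ℤ) :
    Set (Fin r → MvPolynomial V K) :=
  {x | ∀ a, x a ∈ polyComponent K V (j - e a)}

/-- A minimal graded free resolution
`⋯ ⟶ F 2 ⟶ F 1 ⟶ F 0 ⟶ M ⟶ 0`, with `F i = ⨁ (a : Fin (rank i)), S(-shift i a)`, of a finitely
generated `S`-module `M` whose degree `j` component is `ℳ j`. -/
structure MinimalGradedFreeResolution (K V : Type*) [Field K] (M : Type*) [AddCommGroup M]
    [Module (MvPolynomial V K) M] [Module K M] (ℳ : ℤ → Submodule K M) where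
  /-- the rank of `F i` -/
  rank : ℕ → ℕ
  /-- the degrees of the basis vectors of `F i` -/
  shift : (i : ℕ) → Fin (rank i) → ℤ
  /-- the differential `F (i + 1) ⟶ F i` -/
  d : (i : ℕ) →
    (Fin (rank (i + 1)) → MvPolynomial V K) →ₗ[MvPolynomial V K] (Fin (rank i) → MvPolynomial V K)
  /-- the augmentation `F 0 ⟶ M` -/
  aug : (Fin (rank 0) → MvPolynomial V K) →ₗ[MvPolynomial V K] M
  /-- the differentials are homogeneous of degree `0` -/
  d_mem : ∀ i j, ∀ x ∈ freeComponent K V (shift (i + 1)) j, d i x ∈ freeComponent K V (shift i) j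
  /-- the augmentation is homogeneous of degree `0` -/
  aug_mem : ∀ j, ∀ x ∈ freeComponent K V (shift 0) j, aug x ∈ ℳ j
  aug_surjective : Function.Surjective aug
  exact_zero : Function.Exact (d 0) aug
  exact_succ : ∀ i, Function.Exact (d (i + 1)) (d i)
  /-- minimality: the image of `F (i + 1)` lies in `𝔪 F i`, where `𝔪` is the ideal of the
  polynomials without constant term -/
  minimal : ∀ i x a, MvPolynomial.constantCoeff (d i x a) = 0

/-- The graded Betti number `β_{i,j}` read off from a minimal graded free resolution: the number of
summands `S(-j)` in homological degree `i`. -/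
def MinimalGradedFreeResolution.betti {K V : Type*} [Field K] {M : Type*} [AddCommGroup M]
    [Module (MvPolynomial V K) M] [Module K M] {ℳ : ℤ → Submodule K M}
    (F : MinimalGradedFreeResolution K V M ℳ) (i : ℕ) (j : ℤ) : ℕ :=
  Fintype.card {a : Fin (F.rank i) // F.shift i a = j}

/-- The Castelnuovo-Mumford regularity `reg M = max {j - i | β_{i,j}(M) ≠ 0}` of a finitely
generated graded module. The Betti numbers do not depend on the minimal graded free resolution, so
nothing changes when the supremum is taken over all of them at once. The zero module has
regularity `-∞ = ⊥`. -/
def gradedRegularity (K V : Type*) [Field K] (M : Type*) [AddCommGroup M]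
    [Module (MvPolynomial V K) M] [Module K M] (ℳ : ℤ → Submodule K M) : EReal :=
  ⨆ (F : MinimalGradedFreeResolution K V M ℳ) (i : ℕ) (j : ℤ) (_ : F.betti i j ≠ 0),
    (((j - (i : ℤ) : ℤ) : ℝ) : EReal)

/-- The degree `j` component `I ∩ S_j` of a homogeneous ideal `I` of `S`. -/
def idealComponent {K V : Type*} [Field K] (I : Ideal (MvPolynomial V K)) (j : ℤ) :
    Submodule K I :=
  (polyComponent K V j).comap (I.subtype.restrictScalars K)

/-- The regularity of a homogeneous ideal of `S`, as a graded `S`-module. -/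
def idealRegularity {K V : Type*} [Field K] (I : Ideal (MvPolynomial V K)) : EReal :=
  gradedRegularity K V I (idealComponent I)

/-- The `s`-th symbolic power
`I^{(s)} = ⋂ 𝔭 ∈ Min(I), Ker (R → (R / I ^ s)_𝔭)`. -/
def symbolicPower {R : Type*} [CommRing R] (I : Ideal R) (s : ℕ) : Ideal R :=
  ⨅ (p : Ideal R) (hp : p ∈ I.minimalPrimes),
    haveI : p.IsPrime := hp.1.1
    LinearMap.ker
      ((LocalizedModule.mkLinearMap p.primeCompl (R ⧸ I ^ s)).comp (Submodule.mkQ (I ^ s)))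

/-- The edge ideal `I(G) = (x_v x_w : vw ∈ E(G))`. -/
def edgeIdeal (K : Type*) [Field K] {V : Type*} (G : SimpleGraph V) :
    Ideal (MvPolynomial V K) :=
  Ideal.span {f | ∃ v w, G.Adj v w ∧ f = MvPolynomial.X v * MvPolynomial.X w}

end

/-! For an edge product `m = e₁ ⋯ eₛ` the colon ideal `I^{(s+1)} : m` is the squarefree monomial
ideal of the sets that meet all minimal vertex covers containing just one vertex of each `eₖ`. It is
obtained from `I` by the operations `J ↦ (J : x) ∩ (J : y)` for the edges `xy = eₖ`, and these do
not increase the regularity of a squarefree monomial ideal that contains `xy` and is generated in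
degrees at most two.

Starting from `I^{(s+1)} + I^s`, remove the generators of `I^s` one at a time, in increasing
lexicographic order. If `J` is the sum of `I^{(s+1)}` and the generators larger than `m`, then
`J : m` is the sum of `I^{(s+1)} : m` and some variables, because the edge products have an exchange
property relative to a vertex cover. So `reg (J ∩ (m)) = 2s + reg (J : m) ≤ 2s + reg I`, and the
Mayer–Vietoris sequence `0 → J ∩ (m) → J ⊕ (m) → J + (m) → 0` bounds `reg J` by the maximum of
`2s + reg I` and `reg (J + (m))`.

The regularity bounds are obtained from resolutions of monomial ideals that are graded by the
exponents. There `K[x]` acts through the order of the exponents alone, so that a colon ideal is the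
restriction along a monotone map. -/

universe u v

/-- A system of homomorphism groups between degrees: `comp i j` consists of the ring elements that
act from degree `i` to degree `j`, and `deg` is the total degree of an index. Graded modules over a
graded ring and modules graded by a partially ordered set are both families of subgroups on which
such a system acts, so that the two gradings can be treated at once. -/
structure HomSystem (R Γ : Type*) [CommRing R] where
  /-- the total degree -/
  deg : Γ → ℤ
  /-- the ring elements that act from one degree to another -/
  comp : Γ → Γ → AddSubgroup R
  one_mem : ∀ j, 1 ∈ comp j j
  mul_mem : ∀ {i j k a b}, a ∈ comp j k → b ∈ comp i j → a * b ∈ comp i k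

namespace HomSystem

variable {R : Type u} {Γ : Type*} [CommRing R] (𝒜 : HomSystem R Γ)

/-- A family of subgroups is stable if the elements of `𝒜.comp i j` map its degree `i` component to
its degree `j` component: it is then a graded module over `𝒜`. -/
def Stable {E : Type*} [AddCommGroup E] [Module R E] (N : Γ → AddSubgroup E) : Prop :=
  ∀ ⦃i j a x⦄, a ∈ 𝒜.comp i j → x ∈ N i → a • x ∈ N j

/-- The graded free module with basis vectors in the degrees `b`. -/
def free {ι : Type*} (b : ι → Γ) (j : Γ) : AddSubgroup (ι → R) :=
  AddSubgroup.pi Set.univ fun i => 𝒜.comp (b i) j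

section Families

variable {E E' E'' : Type*} [AddCommGroup E] [Module R E] [AddCommGroup E'] [Module R E']
  [AddCommGroup E''] [Module R E'']

/-- The graded kernel of a linear map on a family. -/
def kerFamily (N : Γ → AddSubgroup E) (f : E →ₗ[R] E') (j : Γ) : AddSubgroup E :=
  N j ⊓ f.toAddMonoidHom.ker

/-- The graded image of a family under a linear map. -/
def mapFamily (N : Γ → AddSubgroup E) (f : E →ₗ[R] E') (j : Γ) : AddSubgroup E' :=
  (N j).map f.toAddMonoidHom

/-- The product of two families. -/
def prodFamily (N : Γ → AddSubgroup E) (N' : Γ → AddSubgroup E') (j : Γ) :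
    AddSubgroup (E × E') :=
  (N j).prod (N' j)

/-- A short exact sequence `0 → N → M → Q → 0` of families. -/
structure ShortExact (N : Γ → AddSubgroup E) (M : Γ → AddSubgroup E') (Q : Γ → AddSubgroup E'')
    (i : E →ₗ[R] E') (p : E' →ₗ[R] E'') : Prop where
  injective : Function.Injective i
  map_left : mapFamily N i = kerFamily M p
  map_right : mapFamily M p = Q

end Families

/-- `N` has a free resolution of length `n` whose generators in homological degree `i` have total
degree at most `r + i`. -/
def Resolved : ℕ → ℤ → ∀ {E : Type u} [AddCommGroup E] [Module R E], (Γ → AddSubgroup E) → Prop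
  | 0, _, _, _, _, _ => True
  | n + 1, r, E, _, _, N => ∃ (ι : Type) (_ : Fintype ι) (b : ι → Γ) (f : (ι → R) →ₗ[R] E),
      (∀ i, 𝒜.deg (b i) ≤ r) ∧ mapFamily (𝒜.free b) f = N ∧
        Resolved n (r + 1) (kerFamily (𝒜.free b) f)

variable {𝒜}

section Families

variable {E E' E'' : Type*} [AddCommGroup E] [Module R E] [AddCommGroup E'] [Module R E']
  [AddCommGroup E''] [Module R E'']

theorem mem_free {ι : Type*} {b : ι → Γ} {j : Γ} {c : ι → R} :
    c ∈ 𝒜.free b j ↔ ∀ i, c i ∈ 𝒜.comp (b i) j := by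
  simp only [free, AddSubgroup.mem_pi, Set.mem_univ, true_imp_iff]

theorem mem_kerFamily {N : Γ → AddSubgroup E} {f : E →ₗ[R] E'} {j : Γ} {x : E} :
    x ∈ kerFamily N f j ↔ x ∈ N j ∧ f x = 0 := Iff.rfl

theorem mem_mapFamily {N : Γ → AddSubgroup E} {f : E →ₗ[R] E'} {j : Γ} {y : E'} :
    y ∈ mapFamily N f j ↔ ∃ x ∈ N j, f x = y := Iff.rfl

theorem mem_prodFamily {N : Γ → AddSubgroup E} {N' : Γ → AddSubgroup E'} {j : Γ} {x : E × E'} :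
    x ∈ prodFamily N N' j ↔ x.1 ∈ N j ∧ x.2 ∈ N' j := AddSubgroup.mem_prod

theorem mapFamily_eq_iff {N : Γ → AddSubgroup E} {f : E →ₗ[R] E'} {M : Γ → AddSubgroup E'} :
    mapFamily N f = M ↔ (∀ j, ∀ x ∈ N j, f x ∈ M j) ∧ ∀ j, ∀ y ∈ M j, ∃ x ∈ N j, f x = y := by
  simp only [funext_iff, SetLike.ext_iff, mem_mapFamily]
  exact ⟨fun h => ⟨fun j x hx => (h j _).1 ⟨x, hx, rfl⟩, fun j y => (h j y).2⟩,
    fun h j y => ⟨fun ⟨x, hx, hxy⟩ => hxy ▸ h.1 j x hx, h.2 j y⟩⟩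

theorem mapFamily_id (N : Γ → AddSubgroup E) : mapFamily N (LinearMap.id (R := R)) = N :=
  funext fun j => (N j).map_id

theorem mapFamily_comp (N : Γ → AddSubgroup E) (f : E →ₗ[R] E') (g : E' →ₗ[R] E'') :
    mapFamily N (g ∘ₗ f) = mapFamily (mapFamily N f) g :=
  funext fun j => ((N j).map_map g.toAddMonoidHom f.toAddMonoidHom).symm

theorem mapFamily_injective {f : E →ₗ[R] E'} (hf : Function.Injective f) :
    Function.Injective fun N : Γ → AddSubgroup E => mapFamily N f :=
  fun _ _ h => funext fun j => AddSubgroup.map_injective hf (congrFun h j)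

theorem mapFamily_kerFamily_comp (N : Γ → AddSubgroup E) (f : E →ₗ[R] E') (g : E' →ₗ[R] E'') :
    mapFamily (kerFamily N (g ∘ₗ f)) f = kerFamily (mapFamily N f) g := by
  rw [mapFamily_eq_iff]
  refine ⟨fun j x hx => ⟨⟨x, hx.1, rfl⟩, hx.2⟩, ?_⟩
  rintro j _ ⟨⟨x, hx, rfl⟩, h0⟩
  exact ⟨x, ⟨hx, h0⟩, rfl⟩

theorem kerFamily_comp_of_injective (N : Γ → AddSubgroup E) (f : E →ₗ[R] E') {g : E' →ₗ[R] E''}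
    (hg : Function.Injective g) : kerFamily N (g ∘ₗ f) = kerFamily N f := by
  ext j x
  simp only [mem_kerFamily, LinearMap.comp_apply, map_eq_zero_iff g hg]

theorem stable_free {ι : Type*} (b : ι → Γ) : 𝒜.Stable (𝒜.free b) :=
  fun _ _ _ _ ha hx => mem_free.2 fun k => 𝒜.mul_mem ha (mem_free.1 hx k)

theorem Stable.ker {N : Γ → AddSubgroup E} (hN : 𝒜.Stable N) (f : E →ₗ[R] E') :
    𝒜.Stable (kerFamily N f) := by
  rintro i j a x ha ⟨hx, h0 : f x = 0⟩
  exact mem_kerFamily.2 ⟨hN ha hx, by rw [map_smul, h0, smul_zero]⟩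

theorem Stable.map {N : Γ → AddSubgroup E} (hN : 𝒜.Stable N) (f : E →ₗ[R] E') :
    𝒜.Stable (mapFamily N f) := by
  rintro i j a _ ha ⟨x, hx, rfl⟩
  exact ⟨a • x, hN ha hx, map_smul f a x⟩

theorem Stable.prod {N : Γ → AddSubgroup E} {N' : Γ → AddSubgroup E'} (hN : 𝒜.Stable N)
    (hN' : 𝒜.Stable N') : 𝒜.Stable (prodFamily N N') :=
  fun _ _ _ _ ha hx => mem_prodFamily.2
    ⟨hN ha (mem_prodFamily.1 hx).1, hN' ha (mem_prodFamily.1 hx).2⟩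

theorem single_mem_free {ι : Type*} [DecidableEq ι] (b : ι → Γ) (i : ι) :
    Pi.single i (1 : R) ∈ 𝒜.free b (b i) := by
  rw [mem_free]
  intro k
  obtain rfl | h := eq_or_ne k i
  · simpa only [Pi.single_eq_same] using 𝒜.one_mem _
  · simpa only [Pi.single_eq_of_ne h] using zero_mem _

theorem linearCombination_mem {ι : Type*} [Fintype ι] {b : ι → Γ} {N : Γ → AddSubgroup E}
    (hN : 𝒜.Stable N) {y : ι → E} (hy : ∀ i, y i ∈ N (b i)) {j : Γ} {c : ι → R}
    (hc : c ∈ 𝒜.free b j) : Fintype.linearCombination R y c ∈ N j := by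
  rw [Fintype.linearCombination_apply]
  exact sum_mem fun i _ => hN (mem_free.1 hc i) (hy i)

/-- Graded free modules are projective. -/
theorem exists_lift {ι : Type*} [Finite ι] {b : ι → Γ} {N : Γ → AddSubgroup E}
    {p : E →ₗ[R] E'} {f : (ι → R) →ₗ[R] E'}
    (hf : ∀ j, ∀ c ∈ 𝒜.free b j, f c ∈ mapFamily N p j) :
    ∃ g : (ι → R) →ₗ[R] E, p ∘ₗ g = f ∧
      (𝒜.Stable N → ∀ j, ∀ c ∈ 𝒜.free b j, g c ∈ N j) := by
  classical
  cases nonempty_fintype ι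
  choose y hy hpy using fun i => mem_mapFamily.1 (hf (b i) _ (single_mem_free b i))
  refine ⟨Fintype.linearCombination R y, LinearMap.pi_ext' fun i => LinearMap.ext_ring ?_,
    fun hN j c hc => linearCombination_mem hN hy hc⟩
  simpa [Fintype.linearCombination_apply_single] using hpy i

theorem shortExact_prodFamily (N : Γ → AddSubgroup E) (N' : Γ → AddSubgroup E') :
    ShortExact N (prodFamily N N') N' (LinearMap.inl R E E') (LinearMap.snd R E E') where
  injective := LinearMap.inl_injective
  map_left := by
    refine mapFamily_eq_iff.2 ⟨fun j x hx => ⟨mem_prodFamily.2 ⟨hx, zero_mem _⟩, rfl⟩, ?_⟩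
    rintro j ⟨x, x'⟩ ⟨hx, rfl : x' = 0⟩
    exact ⟨x, (mem_prodFamily.1 hx).1, rfl⟩
  map_right := mapFamily_eq_iff.2 ⟨fun j x hx => (mem_prodFamily.1 hx).2,
    fun j x hx => ⟨(0, x), mem_prodFamily.2 ⟨zero_mem _, hx⟩, rfl⟩⟩

end Families

section Resolved

variable {E E' E'' : Type u} [AddCommGroup E] [Module R E] [AddCommGroup E'] [Module R E']
  [AddCommGroup E''] [Module R E''] {n : ℕ} {r r' : ℤ}

theorem Resolved.mono {N : Γ → AddSubgroup E} (h : 𝒜.Resolved n r N) (hr : r ≤ r') :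
    𝒜.Resolved n r' N := by
  induction n generalizing r r' E with
  | zero => trivial
  | succ n ih =>
    obtain ⟨ι, _, b, f, hb, hN, hK⟩ := h
    exact ⟨ι, inferInstance, b, f, fun k => (hb k).trans hr, hN, ih hK (by lia)⟩

theorem Resolved.of_succ {N : Γ → AddSubgroup E} (h : 𝒜.Resolved (n + 1) r N) :
    𝒜.Resolved n r N := by
  induction n generalizing r E with
  | zero => trivial
  | succ n ih =>
    obtain ⟨ι, _, b, f, hb, hN, hK⟩ := h
    exact ⟨ι, inferInstance, b, f, hb, hN, ih hK⟩

theorem resolved_mapFamily_iff {N : Γ → AddSubgroup E} {f : E →ₗ[R] E'}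
    (hf : Function.Injective f) : 𝒜.Resolved n r (mapFamily N f) ↔ 𝒜.Resolved n r N := by
  cases n with
  | zero => exact Iff.rfl
  | succ n =>
    constructor
    · rintro ⟨ι, _, b, g, hb, hN, hK⟩
      obtain ⟨g, rfl, -⟩ := exists_lift (𝒜 := 𝒜) (N := N) (p := f) (f := g) (b := b)
        fun j c hc => by rw [← hN]; exact ⟨c, hc, rfl⟩
      rw [mapFamily_comp] at hN
      rw [kerFamily_comp_of_injective _ _ hf] at hK
      exact ⟨ι, inferInstance, b, g, hb, mapFamily_injective hf hN, hK⟩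
    · rintro ⟨ι, _, b, g, hb, rfl, hK⟩
      exact ⟨ι, inferInstance, b, f ∘ₗ g, hb, mapFamily_comp _ _ _, by
        rwa [kerFamily_comp_of_injective _ _ hf]⟩

theorem resolved_bot (n : ℕ) (r : ℤ) : 𝒜.Resolved n r (fun _ => (⊥ : AddSubgroup E)) := by
  induction n generalizing r E with
  | zero => trivial
  | succ n ih =>
    refine ⟨Empty, inferInstance, Empty.elim, 0, fun i => i.elim, ?_, ?_⟩
    · exact mapFamily_eq_iff.2 ⟨fun j x _ => rfl, fun j y hy => ⟨0, zero_mem _, hy.symm⟩⟩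
    · convert ih (r + 1) using 1
      exact funext fun j => Subsingleton.elim _ _

theorem resolved_free {ι : Type} [Finite ι] {b : ι → Γ} (hb : ∀ i, 𝒜.deg (b i) ≤ r) (n : ℕ) :
    𝒜.Resolved n r (𝒜.free b) := by
  cases nonempty_fintype ι
  cases n with
  | zero => trivial
  | succ n =>
    refine ⟨ι, inferInstance, b, LinearMap.id, hb, mapFamily_id _, ?_⟩
    convert resolved_bot (𝒜 := 𝒜) (E := ι → R) n (r + 1) using 1
    ext j c
    rw [mem_kerFamily, AddSubgroup.mem_bot]
    exact ⟨fun h => h.2, fun h => ⟨h ▸ zero_mem _, h⟩⟩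

theorem Resolved.of_prod_cover {ι ι' : Type} [Finite ι] [Finite ι'] {b : ι → Γ} {b' : ι' → Γ}
    (hb : ∀ i, 𝒜.deg (b i) ≤ r) (hb' : ∀ i, 𝒜.deg (b' i) ≤ r) (f : (ι → R) × (ι' → R) →ₗ[R] E)
    (hK : 𝒜.Resolved n (r + 1) (kerFamily (prodFamily (𝒜.free b) (𝒜.free b')) f)) :
    𝒜.Resolved (n + 1) r (mapFamily (prodFamily (𝒜.free b) (𝒜.free b')) f) := by
  cases nonempty_fintype ι
  cases nonempty_fintype ι'
  let e := LinearEquiv.sumArrowLequivProdArrow ι ι' R R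
  have he : mapFamily (𝒜.free (Sum.elim b b')) e.toLinearMap
      = prodFamily (𝒜.free b) (𝒜.free b') := by
    refine mapFamily_eq_iff.2 ⟨fun j c hc => ?_, fun j c hc => ⟨e.symm c, ?_, e.apply_symm_apply c⟩⟩
    · exact mem_prodFamily.2 ⟨mem_free.2 fun i => mem_free.1 hc (Sum.inl i),
        mem_free.2 fun i => mem_free.1 hc (Sum.inr i)⟩
    · rw [mem_prodFamily, mem_free, mem_free] at hc
      exact mem_free.2 (Sum.forall.2 hc)
  refine ⟨ι ⊕ ι', inferInstance, Sum.elim b b', f ∘ₗ e.toLinearMap, Sum.forall.2 ⟨hb, hb'⟩, ?_, ?_⟩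
  · rw [mapFamily_comp, he]
  · rwa [← resolved_mapFamily_iff (f := e.toLinearMap) e.injective, mapFamily_kerFamily_comp, he]

namespace ShortExact

variable {N : Γ → AddSubgroup E} {M : Γ → AddSubgroup E'} {Q : Γ → AddSubgroup E''}
  {i : E →ₗ[R] E'} {p : E' →ₗ[R] E''}

theorem comp_eq_zero (h : ShortExact N M Q i p) {j : Γ} {x : E} (hx : x ∈ N j) : p (i x) = 0 :=
  ((mapFamily_eq_iff.1 h.map_left).1 j x hx).2

theorem left_mem (h : ShortExact N M Q i p) {j : Γ} {x : E} (hx : x ∈ N j) : i x ∈ M j :=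
  ((mapFamily_eq_iff.1 h.map_left).1 j x hx).1

theorem exists_left (h : ShortExact N M Q i p) {j : Γ} {y : E'} (hy : y ∈ M j) (h0 : p y = 0) :
    ∃ x ∈ N j, i x = y :=
  (mapFamily_eq_iff.1 h.map_left).2 j y ⟨hy, h0⟩

/-- Covers `f` of `N` and `f'` of `Q`, together with a lift `g` of `f'` to `M`, give a short exact
sequence of syzygies. -/
theorem syzygies (h : ShortExact N M Q i p) {ι ι' : Type*} {b : ι → Γ} {b' : ι' → Γ}
    {f : (ι → R) →ₗ[R] E} {f' : (ι' → R) →ₗ[R] E''} {g : (ι' → R) →ₗ[R] E'}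
    (hf : mapFamily (𝒜.free b) f = N) (hpg : p ∘ₗ g = f') (hg : ∀ j, ∀ c ∈ 𝒜.free b' j, g c ∈ M j) :
    ShortExact (kerFamily (𝒜.free b) f)
      (kerFamily (prodFamily (𝒜.free b) (𝒜.free b')) ((i ∘ₗ f).coprod g))
      (kerFamily (𝒜.free b') f') (LinearMap.inl R _ _) (LinearMap.snd R _ _) where
  injective := LinearMap.inl_injective
  map_left := by
    refine mapFamily_eq_iff.2 ⟨fun j c hc => ⟨⟨mem_prodFamily.2 ⟨hc.1, zero_mem _⟩, ?_⟩, rfl⟩, ?_⟩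
    · have h0 : f c = 0 := hc.2
      simp [h0]
    · rintro j ⟨c, c'⟩ ⟨⟨hc, h0⟩, rfl : c' = 0⟩
      refine ⟨c, ⟨(mem_prodFamily.1 hc).1, h.injective ?_⟩, rfl⟩
      simpa using h0
  map_right := by
    rw [mapFamily_eq_iff] at hf ⊢
    constructor
    · rintro j ⟨c, c'⟩ ⟨hc, h0⟩
      have hc := mem_prodFamily.1 hc
      have h0 : i (f c) + g c' = 0 := h0
      refine mem_kerFamily.2 ⟨hc.2, ?_⟩
      simpa [h.comp_eq_zero (hf.1 j c hc.1), ← hpg] using congrArg p h0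
    · rintro j c' ⟨hc', h0⟩
      obtain ⟨x, hx, hxg⟩ := h.exists_left (hg j c' hc') ((LinearMap.congr_fun hpg c').trans h0)
      obtain ⟨c, hc, rfl⟩ := hf.2 j x hx
      refine ⟨(-c, c'), mem_kerFamily.2 ⟨mem_prodFamily.2 ⟨neg_mem hc, hc'⟩, ?_⟩, rfl⟩
      simp [hxg]

theorem mapFamily_cover (h : ShortExact N M Q i p) {ι ι' : Type*} {b : ι → Γ} {b' : ι' → Γ}
    {f : (ι → R) →ₗ[R] E} {f' : (ι' → R) →ₗ[R] E''} {g : (ι' → R) →ₗ[R] E'}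
    (hf : mapFamily (𝒜.free b) f = N) (hf' : mapFamily (𝒜.free b') f' = Q) (hpg : p ∘ₗ g = f')
    (hg : ∀ j, ∀ c ∈ 𝒜.free b' j, g c ∈ M j) :
    mapFamily (prodFamily (𝒜.free b) (𝒜.free b')) ((i ∘ₗ f).coprod g) = M := by
  rw [mapFamily_eq_iff] at hf hf' ⊢
  refine ⟨fun j c hc => ?_, fun j y hy => ?_⟩
  · rw [mem_prodFamily] at hc
    exact add_mem (h.left_mem (hf.1 j _ hc.1)) (hg j _ hc.2)
  · obtain ⟨c', hc', hyc'⟩ := hf'.2 j (p y) ((mapFamily_eq_iff.1 h.map_right).1 j y hy)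
    have hpgc' : p (g c') = p y := (LinearMap.congr_fun hpg c').trans hyc'
    obtain ⟨x, hx, hxy⟩ := h.exists_left (sub_mem hy (hg j c' hc'))
      (by rw [map_sub, hpgc', sub_self])
    obtain ⟨c, hc, rfl⟩ := hf.2 j x hx
    exact ⟨(c, c'), mem_prodFamily.2 ⟨hc, hc'⟩, by simp [hxy]⟩

/-- The horseshoe lemma. -/
theorem resolved_middle (h : ShortExact N M Q i p) (hM : 𝒜.Stable M) (hN : 𝒜.Resolved n r N)
    (hQ : 𝒜.Resolved n r Q) : 𝒜.Resolved n r M := by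
  induction n generalizing r E E' E'' with
  | zero => trivial
  | succ n ih =>
    obtain ⟨ι, _, b, f, hb, hf, hK⟩ := hN
    obtain ⟨ι', _, b', f', hb', hf', hK'⟩ := hQ
    obtain ⟨g, hpg, hg⟩ := exists_lift (𝒜 := 𝒜) (N := M) (p := p) (f := f') (b := b')
      fun j c hc => by rw [h.map_right, ← hf']; exact ⟨c, hc, rfl⟩
    rw [← h.mapFamily_cover hf hf' hpg (hg hM)]
    exact Resolved.of_prod_cover hb hb' _ <|
      ih (h.syzygies hf hpg (hg hM)) (((stable_free b).prod (stable_free b')).ker _) hK hK'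

theorem resolved_right (h : ShortExact N M Q i p) (hN : 𝒜.Resolved n (r + 1) N)
    (hM : 𝒜.Resolved (n + 1) r M) : 𝒜.Resolved (n + 1) r Q := by
  obtain ⟨ι, _, b, f, hb, rfl, hK⟩ := hM
  refine ⟨ι, inferInstance, b, p ∘ₗ f, hb, (mapFamily_comp _ _ _).trans h.map_right, ?_⟩
  have hsyz : ShortExact (kerFamily (𝒜.free b) f) (kerFamily (𝒜.free b) (p ∘ₗ f))
      (mapFamily N i) LinearMap.id f :=
    { injective := Function.injective_id
      map_left := by
        ext j c
        simp only [mapFamily_id, mem_kerFamily, LinearMap.comp_apply]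
        exact ⟨fun hc => ⟨⟨hc.1, by rw [hc.2, map_zero]⟩, hc.2⟩, fun hc => ⟨hc.1.1, hc.2⟩⟩
      map_right := by rw [mapFamily_kerFamily_comp, h.map_left] }
  exact hsyz.resolved_middle ((stable_free b).ker _) hK ((resolved_mapFamily_iff h.injective).2 hN)

section Pullback

/-- The pullback of a map `p : E → E''` and a map `f` from a free module to `E''`. -/
private def pullback {ι : Type*} (𝒜 : HomSystem R Γ) (M : Γ → AddSubgroup E') (p : E' →ₗ[R] E'')
    (b : ι → Γ) (f : (ι → R) →ₗ[R] E'') : Γ → AddSubgroup (E' × (ι → R)) :=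
  kerFamily (prodFamily M (𝒜.free b)) (p.coprod (-f))

variable {ι : Type*} {b : ι → Γ} {f : (ι → R) →ₗ[R] E''}

private theorem mem_pullback {j : Γ} {x : E' × (ι → R)} :
    x ∈ pullback 𝒜 M p b f j ↔ (x.1 ∈ M j ∧ x.2 ∈ 𝒜.free b j) ∧ p x.1 = f x.2 := by
  simp only [pullback, mem_kerFamily, mem_prodFamily, LinearMap.coprod_apply,
    LinearMap.neg_apply, ← sub_eq_add_neg, sub_eq_zero]

private theorem shortExact_pullback_fst (hf : mapFamily (𝒜.free b) f = mapFamily M p) :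
    ShortExact (kerFamily (𝒜.free b) f) (pullback 𝒜 M p b f) M
      (LinearMap.inr R _ _) (LinearMap.fst R _ _) where
  injective := LinearMap.inr_injective
  map_left := by
    refine mapFamily_eq_iff.2 ⟨fun j c hc => ⟨mem_pullback.2 ⟨⟨zero_mem _, hc.1⟩, ?_⟩, rfl⟩, ?_⟩
    · exact (map_zero p).trans hc.2.symm
    · rintro j ⟨y, c⟩ ⟨hc, rfl : y = 0⟩
      have hc := mem_pullback.1 hc
      exact ⟨c, ⟨hc.1.2, hc.2.symm.trans (map_zero p)⟩, rfl⟩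
  map_right := by
    refine mapFamily_eq_iff.2 ⟨fun j y hy => (mem_pullback.1 hy).1.1, fun j y hy => ?_⟩
    obtain ⟨c, hc, hcy⟩ := mem_mapFamily.1 (hf ▸ mem_mapFamily.2 ⟨y, hy, rfl⟩)
    exact ⟨(y, c), mem_pullback.2 ⟨⟨hy, hc⟩, hcy.symm⟩, rfl⟩

private theorem shortExact_pullback_ker {g : (ι → R) →ₗ[R] E'} (hpg : p ∘ₗ g = f)
    (hg : ∀ j, ∀ c ∈ 𝒜.free b j, g c ∈ M j) :
    ShortExact (𝒜.free b) (pullback 𝒜 M p b f) (kerFamily M p)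
      (g.prod LinearMap.id) (LinearMap.fst R _ _ - g ∘ₗ LinearMap.snd R _ _) where
  injective _ _ hcc' := congrArg Prod.snd hcc'
  map_left := by
    refine mapFamily_eq_iff.2 ⟨fun j c hc => ⟨mem_pullback.2 ⟨⟨hg j c hc, hc⟩, ?_⟩, sub_self _⟩, ?_⟩
    · exact LinearMap.congr_fun hpg c
    · rintro j ⟨y, c⟩ ⟨hc, h0 : y - g c = 0⟩
      exact ⟨c, (mem_pullback.1 hc).1.2, Prod.ext (sub_eq_zero.1 h0).symm rfl⟩
  map_right := by
    refine mapFamily_eq_iff.2 ⟨fun j y hy => ?_, fun j y hy => ⟨(y, 0), mem_pullback.2 ?_, ?_⟩⟩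
    · obtain ⟨⟨h₁, h₂⟩, h₃⟩ := mem_pullback.1 hy
      refine mem_kerFamily.2 ⟨sub_mem h₁ (hg j _ h₂), ?_⟩
      simpa [sub_eq_zero, h₃] using (LinearMap.congr_fun hpg y.2).symm
    · exact ⟨⟨hy.1, zero_mem _⟩, (show p y = 0 from hy.2).trans (map_zero f).symm⟩
    · simp

end Pullback

theorem resolved_left (h : ShortExact N M Q i p) (hM : 𝒜.Stable M) (hMr : 𝒜.Resolved n r M)
    (hQ : 𝒜.Resolved (n + 1) (r - 1) Q) : 𝒜.Resolved n r N := by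
  cases n with
  | zero => trivial
  | succ n =>
    obtain ⟨ι, _, b, f, hb, hf, hK⟩ := hQ
    obtain ⟨g, hpg, hg⟩ := exists_lift (𝒜 := 𝒜) (N := M) (p := p) (f := f) (b := b)
      fun j c hc => by rw [h.map_right, ← hf]; exact ⟨c, hc, rfl⟩
    have hpull : 𝒜.Resolved (n + 1) r (pullback 𝒜 M p b f) :=
      (shortExact_pullback_fst (hf.trans h.map_right.symm)).resolved_middle
        ((hM.prod (stable_free b)).ker _) (by rwa [sub_add_cancel] at hK) hMr
    have hfree : 𝒜.Resolved n (r + 1) (𝒜.free b) :=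
      resolved_free (fun k => (hb k).trans (by lia)) n
    rw [← resolved_mapFamily_iff h.injective, h.map_left]
    exact (shortExact_pullback_ker hpg (hg hM)).resolved_right hfree hpull

end ShortExact

theorem shortExact_kerFamily (N : Γ → AddSubgroup E) (f : E →ₗ[R] E') :
    ShortExact (kerFamily N f) N (mapFamily N f) LinearMap.id f where
  injective := Function.injective_id
  map_left := mapFamily_id _
  map_right := rfl

end Resolved

end HomSystem

namespace HomSystem

/-- The homomorphism system of a preorder with degree function `deg`: all scalars act between
degrees `i ≤ j`, and only `0` acts otherwise. Its stable families are the filtrations of modules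
indexed by the preorder. -/
def ofPreorder (K : Type*) {Γ : Type*} [CommRing K] [Preorder Γ] (deg : Γ → ℤ) :
    HomSystem K Γ where
  deg := deg
  comp i j := ⨆ _ : i ≤ j, ⊤
  one_mem j := by simp
  mul_mem {i j k a b} ha hb := by
    by_cases hij : i ≤ j
    · by_cases hjk : j ≤ k
      · simp [hij.trans hjk]
      · obtain rfl : a = 0 := by simpa [hjk] using ha
        simp
    · obtain rfl : b = 0 := by simpa [hij] using hb
      simp

section Preorder

variable {K : Type u} {Γ : Type*} [CommRing K] [Preorder Γ] {deg : Γ → ℤ}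

theorem mem_comp_ofPreorder {i j : Γ} {a : K} :
    a ∈ (ofPreorder K deg).comp i j ↔ (a ≠ 0 → i ≤ j) := by
  by_cases h : i ≤ j <;> simp [ofPreorder, h]

theorem mem_free_ofPreorder {ι : Type*} {b : ι → Γ} {a : Γ} {c : ι → K} :
    c ∈ (ofPreorder K deg).free b a ↔ ∀ i, c i ≠ 0 → b i ≤ a := by
  simp only [mem_free, mem_comp_ofPreorder]

end Preorder

section ExtendByZero

variable {K : Type u} {ι : Type*} [CommRing K] {P : ι → Prop}

/-- The inclusion of the free module on a part of a basis. -/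
noncomputable def extendByZero (K : Type u) [CommRing K] (P : ι → Prop) :
    ({i // P i} → K) →ₗ[K] (ι → K) :=
  Function.ExtendByZero.linearMap K Subtype.val

theorem extendByZero_apply (c : {i // P i} → K) (i : {i // P i}) :
    extendByZero K P c i = c i :=
  Subtype.val_injective.extend_apply _ _ i

theorem extendByZero_apply_of_not (c : {i // P i} → K) {i : ι} (hi : ¬ P i) :
    extendByZero K P c i = 0 :=
  Function.extend_apply' _ _ _ fun ⟨k, hk⟩ => hi (hk ▸ k.2)

theorem extendByZero_injective : Function.Injective (extendByZero K P) :=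
  fun c c' h => funext fun i => by rw [← extendByZero_apply c, h, extendByZero_apply]

theorem extendByZero_restrict {x : ι → K} (hx : ∀ i, ¬ P i → x i = 0) :
    extendByZero K P (fun i => x i) = x := by
  funext i
  by_cases hi : P i
  · exact extendByZero_apply _ ⟨i, hi⟩
  · rw [extendByZero_apply_of_not _ hi, hx i hi]

variable {Γ : Type*} {𝒜 : HomSystem K Γ} {b : ι → Γ}

theorem mem_free_restrict_iff {j : Γ} {c : {i // P i} → K} :
    c ∈ 𝒜.free (fun i : {i // P i} => b i) j ↔ extendByZero K P c ∈ 𝒜.free b j := by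
  rw [mem_free, mem_free]
  refine ⟨fun h i => ?_, fun h i => by simpa only [extendByZero_apply] using h i⟩
  by_cases hi : P i
  · simpa only [extendByZero_apply c ⟨i, hi⟩] using h ⟨i, hi⟩
  · simpa only [extendByZero_apply_of_not c hi] using zero_mem _

variable {E : Type*} [AddCommGroup E] [Module K E] {f : (ι → K) →ₗ[K] E}

theorem map_extendByZero_restrict [Finite ι] [DecidableEq ι]
    (hf : ∀ i, ¬ P i → f (Pi.single i 1) = 0) (x : ι → K) :
    f (extendByZero K P fun i => x i) = f x := by
  cases nonempty_fintype ι
  classical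
  rw [← sub_eq_zero, ← map_sub, pi_eq_sum_univ' (_ - x), map_sum]
  refine Finset.sum_eq_zero fun i _ => ?_
  by_cases hi : P i
  · simp [extendByZero_apply _ ⟨i, hi⟩]
  · rw [map_smul, hf i hi, smul_zero]

theorem mapFamily_comp_extendByZero [Finite ι] [DecidableEq ι]
    (hf : ∀ i, ¬ P i → f (Pi.single i 1) = 0) :
    mapFamily (𝒜.free fun i : {i // P i} => b i) (f ∘ₗ extendByZero K P)
      = mapFamily (𝒜.free b) f := by
  refine mapFamily_eq_iff.2 ⟨fun j c hc => ⟨_, mem_free_restrict_iff.1 hc, rfl⟩, ?_⟩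
  rintro j _ ⟨x, hx, rfl⟩
  exact ⟨fun i => x i, mem_free.2 fun i => mem_free.1 hx i, map_extendByZero_restrict hf x⟩

theorem shortExact_kerFamily_comp_extendByZero [Finite ι] [DecidableEq ι]
    (hf : ∀ i, ¬ P i → f (Pi.single i 1) = 0) :
    ShortExact (kerFamily (𝒜.free fun i : {i // P i} => b i) (f ∘ₗ extendByZero K P))
      (kerFamily (𝒜.free b) f) (𝒜.free fun i : {i // ¬ P i} => b i)
      (extendByZero K P) (LinearMap.funLeft K K Subtype.val) where
  injective := extendByZero_injective
  map_left := by
    refine mapFamily_eq_iff.2 ⟨fun j c hc => ⟨⟨mem_free_restrict_iff.1 hc.1, hc.2⟩, ?_⟩, ?_⟩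
    · exact funext fun i => extendByZero_apply_of_not c i.2
    · rintro j x ⟨hx, h0⟩
      have hext : extendByZero K P (fun i => x i) = x :=
        extendByZero_restrict fun i hi => congrFun h0 ⟨i, hi⟩
      refine ⟨fun i => x i, ⟨mem_free.2 fun i => mem_free.1 hx.1 i, ?_⟩, hext⟩
      exact (congrArg f hext).trans hx.2
  map_right := by
    refine mapFamily_eq_iff.2
      ⟨fun j x hx => mem_free.2 fun i => mem_free.1 hx.1 i, fun j y hy => ?_⟩
    refine ⟨extendByZero K _ y, ⟨mem_free_restrict_iff.1 hy, ?_⟩, funext (extendByZero_apply y)⟩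
    refine (map_extendByZero_restrict hf _).symm.trans ?_
    rw [show (fun i : {i // P i} => extendByZero K (fun i => ¬ P i) y i) = 0 from
      funext fun i => extendByZero_apply_of_not y (not_not.2 i.2), map_zero, map_zero]

end ExtendByZero

section Comp

variable {K : Type u} {Γ : Type*} [CommRing K] [Preorder Γ] {deg : Γ → ℤ}

theorem mapFamily_free_extendByZero {ι : Type*} {P : ι → Prop} {b : ι → Γ} {l : {i // P i} → Γ}
    {φ : Γ → Γ} (hl : ∀ i a, b i.1 ≤ φ a ↔ l i ≤ a) (hP : ∀ i, ¬ P i → ∀ a, ¬ b i ≤ φ a) :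
    mapFamily ((ofPreorder K deg).free l) (extendByZero K P)
      = fun a => (ofPreorder K deg).free b (φ a) := by
  refine mapFamily_eq_iff.2 ⟨fun a c hc => mem_free_ofPreorder.2 fun i hi => ?_, fun a x hx => ?_⟩
  · obtain hPi : P i := of_not_not fun h => hi (extendByZero_apply_of_not c h)
    rw [extendByZero_apply c ⟨i, hPi⟩] at hi
    exact (hl ⟨i, hPi⟩ a).2 (mem_free_ofPreorder.1 hc _ hi)
  · rw [mem_free_ofPreorder] at hx
    exact ⟨_, mem_free_ofPreorder.2 fun i hi => (hl i a).1 (hx _ hi),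
      extendByZero_restrict fun i hi => not_not.1 fun h => hP i hi a (hx i h)⟩

/-- If `φ` has a partial left adjoint that does not increase degrees, then restriction along `φ`
turns a free module into the free module on the images, under the adjoint, of the degrees where the
latter is defined. -/
theorem Resolved.comp {φ : Γ → Γ}
    (hφ : ∀ b, (∃ c, deg c ≤ deg b ∧ ∀ a, b ≤ φ a ↔ c ≤ a) ∨ ∀ a, ¬ b ≤ φ a)
    {E : Type u} [AddCommGroup E] [Module K E] {N : Γ → AddSubgroup E} {n : ℕ} {r : ℤ}
    (h : (ofPreorder K deg).Resolved n r N) :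
    (ofPreorder K deg).Resolved n r fun a => N (φ a) := by
  classical
  induction n generalizing r E with
  | zero => trivial
  | succ n ih =>
    obtain ⟨ι, _, b, f, hb, rfl, hK⟩ := h
    let P : ι → Prop := fun i => ∃ c, deg c ≤ deg (b i) ∧ ∀ a, b i ≤ φ a ↔ c ≤ a
    choose l hlb hl using fun i : {i // P i} => i.2
    have he := mapFamily_free_extendByZero (K := K) (deg := deg) hl
      fun i hi => (hφ (b i)).resolve_left hi
    refine ⟨{i // P i}, inferInstance, l, f ∘ₗ extendByZero K P,
      fun i => (hlb i).trans (hb i), ?_, ?_⟩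
    · rw [mapFamily_comp, he]
      rfl
    · rw [← resolved_mapFamily_iff extendByZero_injective, mapFamily_kerFamily_comp, he]
      exact ih hK

end Comp

section Translate

variable {K : Type u} [CommRing K] {V : Type*} {E : Type u} [AddCommGroup E] [Module K E]

open Classical in
/-- The family `N` moved up by the exponent `c`. -/
noncomputable def translate (c : V →₀ ℕ) (N : (V →₀ ℕ) → AddSubgroup E) (a : V →₀ ℕ) :
    AddSubgroup E :=
  if c ≤ a then N (a - c) else ⊥

theorem mem_translate {c a : V →₀ ℕ} {N : (V →₀ ℕ) → AddSubgroup E} {x : E} :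
    x ∈ translate c N a ↔ (x ≠ 0 → c ≤ a) ∧ x ∈ N (a - c) := by
  by_cases h : c ≤ a
  · simp [translate, h]
  · simp only [translate, h, if_false, AddSubgroup.mem_bot, imp_false, not_not]
    exact ⟨fun h => ⟨h, h ▸ zero_mem _⟩, And.left⟩

theorem translate_add (c a : V →₀ ℕ) (N : (V →₀ ℕ) → AddSubgroup E) :
    translate c N (a + c) = N a := by
  rw [translate, if_pos le_add_self, add_tsub_cancel_right]

theorem translate_injective (c : V →₀ ℕ) :
    Function.Injective (translate (E := E) c) := fun N N' h => funext fun a => by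
  rw [← translate_add c a N, h, translate_add]

variable {E' : Type*} [AddCommGroup E'] [Module K E']

theorem mapFamily_translate (c : V →₀ ℕ) (N : (V →₀ ℕ) → AddSubgroup E) (f : E →ₗ[K] E') :
    mapFamily (translate c N) f = translate c (mapFamily N f) := by
  funext a
  by_cases h : c ≤ a
  · simp only [mapFamily, translate, h, if_true]
  · simp only [mapFamily, translate, h, if_false, AddSubgroup.map_bot]

theorem kerFamily_translate (c : V →₀ ℕ) (N : (V →₀ ℕ) → AddSubgroup E) (f : E →ₗ[K] E') :
    kerFamily (translate c N) f = translate c (kerFamily N f) := by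
  ext a x
  simp only [mem_kerFamily, mem_translate, and_assoc]

variable {deg : (V →₀ ℕ) → ℤ}

theorem free_add {ι : Type*} (b : ι → V →₀ ℕ) (c : V →₀ ℕ) :
    (ofPreorder K deg).free (fun i => b i + c) = translate c ((ofPreorder K deg).free b) := by
  ext a x
  simp only [mem_translate, mem_free_ofPreorder]
  refine ⟨fun h => ⟨fun hx => ?_, fun i hi => le_tsub_of_add_le_right (h i hi)⟩, fun h i hi => ?_⟩
  · obtain ⟨i, hi⟩ := Function.ne_iff.1 hx
    exact le_add_self.trans (h i hi)
  · have hx : x ≠ 0 := fun h0 => hi (congrFun h0 i)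
    exact add_le_of_le_tsub_right_of_le (h.1 hx) (h.2 i hi)

end Translate

end HomSystem

section Exponents

open HomSystem

/-- The system of the multigraded modules over a polynomial ring with variables `V`: a multigraded
module is regarded as a family of subgroups of the colimit along the multiplications by monomials,
so that all monomials act as `1`. -/
noncomputable abbrev exponentSystem (K : Type u) [CommRing K] (V : Type*) : HomSystem K (V →₀ ℕ) :=
  ofPreorder K fun a => (a.degree : ℤ)

namespace HomSystem

variable {K : Type u} [CommRing K] {V : Type*} {E : Type u} [AddCommGroup E] [Module K E]

theorem Resolved.translate {N : (V →₀ ℕ) → AddSubgroup E} {n : ℕ} {r : ℤ}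
    (h : (exponentSystem K V).Resolved n r N) (c : V →₀ ℕ) :
    (exponentSystem K V).Resolved n (r + c.degree) (translate c N) := by
  induction n generalizing r E with
  | zero => trivial
  | succ n ih =>
    obtain ⟨ι, _, b, f, hb, rfl, hK⟩ := h
    refine ⟨ι, inferInstance, fun i => b i + c, f, fun i => ?_, ?_, ?_⟩
    · have hbi : ((b i).degree : ℤ) ≤ r := hb i
      simpa [exponentSystem, ofPreorder] using hbi
    · rw [free_add, mapFamily_translate]
    · rw [free_add, kerFamily_translate, add_right_comm]
      exact ih hK

theorem resolved_of_translate {N : (V →₀ ℕ) → AddSubgroup E} {n : ℕ} {r : ℤ} {c : V →₀ ℕ}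
    (h : (exponentSystem K V).Resolved n (r + c.degree) (translate c N)) :
    (exponentSystem K V).Resolved n r N := by
  classical
  induction n generalizing r E with
  | zero => trivial
  | succ n ih =>
    obtain ⟨ι, _, b, f, hb, hN, hK⟩ := h
    have hf : ∀ i, ¬ c ≤ b i → f (Pi.single i 1) = 0 := fun i hi => by
      have hmem := (mapFamily_eq_iff.1 hN).1 _ _ (single_mem_free b i)
      exact of_not_not fun h0 => hi ((mem_translate.1 hmem).1 h0)
    have hfree : (exponentSystem K V).free (fun i : {i // c ≤ b i} => b i)
        = translate c ((exponentSystem K V).free fun i : {i // c ≤ b i} => b i - c) := by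
      rw [← free_add]
      exact congrArg _ (funext fun i => (tsub_add_cancel_of_le i.2).symm)
    have hsyz := (shortExact_kerFamily_comp_extendByZero (𝒜 := exponentSystem K V) (b := b)
      hf).resolved_left ((stable_free b).ker f) hK (resolved_free (fun i => by simpa using hb i) _)
    rw [hfree, kerFamily_translate, add_right_comm] at hsyz
    refine ⟨{i // c ≤ b i}, inferInstance, fun i => b i - c, f ∘ₗ extendByZero K _, fun i => ?_,
      ?_, ih hsyz⟩
    · have hbi : ((b i).degree : ℤ) ≤ r + c.degree := hb i
      rw [← tsub_add_cancel_of_le i.2, map_add] at hbi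
      exact le_of_add_le_add_right (by exact_mod_cast hbi)
    · refine translate_injective c ?_
      rw [← mapFamily_translate, ← hfree, mapFamily_comp_extendByZero hf, hN]

theorem resolved_translate_iff {N : (V →₀ ℕ) → AddSubgroup E} {n : ℕ} {r : ℤ} {c : V →₀ ℕ} :
    (exponentSystem K V).Resolved n (r + c.degree) (translate c N) ↔
      (exponentSystem K V).Resolved n r N :=
  ⟨resolved_of_translate, fun h => h.translate c⟩

section MonomialFamily

variable {K : Type u} {Γ : Type*} [CommRing K]

open Classical in
/-- The monomial ideal with exponent set `U`, as a multigraded module: `K` in the degrees that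
belong to `U`, and zero in the others. -/
noncomputable def monomialFamily (K : Type*) {Γ : Type*} [CommRing K] (U : Set Γ) (a : Γ) :
    AddSubgroup K :=
  if a ∈ U then ⊤ else ⊥

variable {U W : Set Γ}

theorem mem_monomialFamily {a : Γ} {x : K} : x ∈ monomialFamily K U a ↔ (x ≠ 0 → a ∈ U) := by
  by_cases h : a ∈ U <;> simp [monomialFamily, h]

theorem shortExact_monomialFamily (U W : Set Γ) :
    ShortExact (monomialFamily K (U ∩ W)) (prodFamily (monomialFamily K U) (monomialFamily K W))
      (monomialFamily K (U ∪ W)) (LinearMap.id.prod (-LinearMap.id) : K →ₗ[K] K × K)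
      (LinearMap.id.coprod LinearMap.id) where
  injective _ _ hxy := congrArg Prod.fst hxy
  map_left := by
    simp only [mapFamily_eq_iff, mem_kerFamily, mem_prodFamily, mem_monomialFamily]
    refine ⟨fun a x hx => ⟨⟨fun h => (hx h).1, fun h => (hx (neg_ne_zero.1 h)).2⟩,
      add_neg_cancel x⟩, ?_⟩
    rintro a ⟨x, y⟩ ⟨⟨hx, hy⟩, hxy : x + y = 0⟩
    obtain rfl := eq_neg_of_add_eq_zero_right hxy
    exact ⟨x, fun h => ⟨hx h, hy (neg_ne_zero.2 h)⟩, rfl⟩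
  map_right := by
    simp only [mapFamily_eq_iff, mem_prodFamily, mem_monomialFamily]
    refine ⟨fun a x hx h => ?_, fun a x hx => ?_⟩
    · by_contra ha
      obtain ⟨haU, haW⟩ := not_or.1 ha
      refine h ?_
      simp [not_not.1 (mt hx.1 haU), not_not.1 (mt hx.2 haW)]
    · by_cases haU : a ∈ U
      · exact ⟨(x, 0), ⟨fun _ => haU, fun h => absurd rfl h⟩, add_zero x⟩
      · exact ⟨(0, x), ⟨fun h => absurd rfl h, fun h => (hx h).resolve_left haU⟩, zero_add x⟩

theorem monomialFamily_empty : monomialFamily K (∅ : Set Γ) = fun _ => ⊥ :=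
  funext fun _ => if_neg (Set.notMem_empty _)

variable [Preorder Γ] {deg : Γ → ℤ} {n : ℕ} {r : ℤ}

theorem stable_monomialFamily (hU : IsUpperSet U) :
    (ofPreorder K deg).Stable (monomialFamily K U) := fun i j a x ha hx => by
  rw [mem_monomialFamily] at hx ⊢
  exact fun h => hU (mem_comp_ofPreorder.1 ha (left_ne_zero_of_mul h))
    (hx (right_ne_zero_of_mul h))

theorem resolved_monomialFamily_Ici {c : Γ} (hc : deg c ≤ r) (n : ℕ) :
    (ofPreorder K deg).Resolved n r (monomialFamily K (Set.Ici c)) := by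
  have hfree : mapFamily ((ofPreorder K deg).free fun _ : Unit => c)
      (LinearMap.proj (R := K) (φ := fun _ => K) ()) = monomialFamily K (Set.Ici c) := by
    simp only [mapFamily_eq_iff, mem_free_ofPreorder, mem_monomialFamily]
    exact ⟨fun a x hx => hx (), fun a x hx => ⟨fun _ => x, fun _ => hx, rfl⟩⟩
  rw [← hfree, resolved_mapFamily_iff fun x y h => funext fun _ => h]
  exact resolved_free (fun _ => hc) n

theorem resolved_monomialFamily_prod (hU : IsUpperSet U) (hW : IsUpperSet W)
    (h : (ofPreorder K deg).Resolved n r (monomialFamily K U))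
    (h' : (ofPreorder K deg).Resolved n r (monomialFamily K W)) :
    (ofPreorder K deg).Resolved n r (prodFamily (monomialFamily K U) (monomialFamily K W)) :=
  (shortExact_prodFamily _ _).resolved_middle
    ((stable_monomialFamily hU).prod (stable_monomialFamily hW)) h h'

end MonomialFamily

theorem translate_monomialFamily {K V : Type*} [CommRing K] (c : V →₀ ℕ)
    (U : Set (V →₀ ℕ)) :
    translate c (monomialFamily K U) = monomialFamily K {a | c ≤ a ∧ a - c ∈ U} := by
  ext a x
  simp only [mem_translate, mem_monomialFamily, Set.mem_ofPred_eq]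
  exact imp_and.symm

end HomSystem

/-- The monomial ideal with exponent set `U` has multigraded free resolutions, of any prescribed
length, whose generators in homological degree `i` have degree at most `r + i`. -/
def RegLE (K : Type u) [CommRing K] {V : Type*} (r : ℤ) (U : Set (V →₀ ℕ)) : Prop :=
  ∀ n, (exponentSystem K V).Resolved n r (monomialFamily K U)

namespace RegLE

variable {K : Type u} [CommRing K] {V : Type*} {r r' : ℤ} {U W : Set (V →₀ ℕ)}

theorem mono (h : RegLE K r U) (hr : r ≤ r') : RegLE K r' U :=
  fun n => (h n).mono hr

theorem empty : RegLE K r (∅ : Set (V →₀ ℕ)) := fun n => by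
  rw [monomialFamily_empty]
  exact resolved_bot n r

theorem Ici {c : V →₀ ℕ} (hc : (c.degree : ℤ) ≤ r) : RegLE K r (Set.Ici c) :=
  resolved_monomialFamily_Ici hc

theorem union (hU : IsUpperSet U) (hW : IsUpperSet W) (h₁ : RegLE K r U) (h₂ : RegLE K r W)
    (h₃ : RegLE K (r + 1) (U ∩ W)) : RegLE K r (U ∪ W) := fun n =>
  ((shortExact_monomialFamily U W).resolved_right (h₃ n)
    (resolved_monomialFamily_prod hU hW (h₁ (n + 1)) (h₂ (n + 1)))).of_succ

theorem inter (hU : IsUpperSet U) (hW : IsUpperSet W) (h₁ : RegLE K r U) (h₂ : RegLE K r W)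
    (h₃ : RegLE K (r - 1) (U ∪ W)) : RegLE K r (U ∩ W) := fun n =>
  (shortExact_monomialFamily U W).resolved_left
    ((stable_monomialFamily hU).prod (stable_monomialFamily hW))
    (resolved_monomialFamily_prod hU hW (h₁ n) (h₂ n)) (h₃ (n + 1))

theorem left_of_union_of_inter (hU : IsUpperSet U) (hW : IsUpperSet W)
    (h₁ : RegLE K r (U ∪ W)) (h₂ : RegLE K r (U ∩ W)) (h₃ : RegLE K (r + 1) W) : RegLE K r U := by
  intro n
  have hprod : (exponentSystem K V).Resolved (n + 1) r
      (prodFamily (monomialFamily K W) (monomialFamily K U)) :=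
    (shortExact_monomialFamily W U).resolved_middle
      ((stable_monomialFamily hW).prod (stable_monomialFamily hU))
      (Set.inter_comm U W ▸ h₂ (n + 1)) (Set.union_comm U W ▸ h₁ (n + 1))
  exact ((shortExact_prodFamily _ _).resolved_right (h₃ n) hprod).of_succ

theorem colon (h : RegLE K r U) (c : V →₀ ℕ) : RegLE K r {a | a + c ∈ U} := fun n =>
  (h n).comp (φ := fun a => a + c) fun b => Or.inl ⟨b - c,
    by exact_mod_cast Finsupp.degree_mono tsub_le_self, fun a => tsub_le_iff_right.symm⟩

theorem filter (h : RegLE K r U) (P : V → Prop) [DecidablePred P] :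
    RegLE K r {a | a.filter P ∈ U} := by
  intro n
  refine (h n).comp (φ := fun a => a.filter P) fun b => ?_
  by_cases hP : ∀ v, ¬ P v → b v = 0
  · refine Or.inl ⟨b, le_rfl, fun a => forall_congr' fun v => ?_⟩
    by_cases hv : P v
    · rw [Finsupp.filter_apply_pos _ _ hv]
    · simp only [hP v hv, zero_le]
  · push Not at hP
    obtain ⟨v, hv, hbv⟩ := hP
    refine Or.inr fun a hba => hbv ?_
    simpa only [Finsupp.filter_apply_neg _ _ hv, Nat.le_zero] using hba v

theorem shift_iff {c : V →₀ ℕ} :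
    RegLE K (r + c.degree) {a | c ≤ a ∧ a - c ∈ U} ↔ RegLE K r U := by
  simp only [RegLE, ← translate_monomialFamily, resolved_translate_iff]

/-- `I ∩ (x ^ c) = x ^ c (I : x ^ c)`. -/
theorem inter_Ici (h : RegLE K r U) (c : V →₀ ℕ) : RegLE K (r + c.degree) (U ∩ Set.Ici c) := by
  convert shift_iff.2 (h.colon c) using 1
  ext a
  simp only [Set.mem_inter_iff, Set.mem_Ici, Set.mem_ofPred_eq, and_comm (a := a ∈ U)]
  exact and_congr_right fun h => by rw [tsub_add_cancel_of_le h]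

theorem union_variable (hU : IsUpperSet U) (h : RegLE K r U) (hr : 1 ≤ r) (z : V) :
    RegLE K r (U ∪ Set.Ici (Finsupp.single z 1)) := by
  refine h.union hU (isUpperSet_Ici _) (Ici (by simpa using hr)) ?_
  simpa using h.inter_Ici (Finsupp.single z 1)

theorem union_variables (hU : IsUpperSet U) (h : RegLE K r U) (hr : 1 ≤ r) (Z : Finset V) :
    RegLE K r (U ∪ {a | ∃ z ∈ Z, a z ≠ 0}) := by
  classical
  induction Z using Finset.induction_on with
  | empty => simpa using h
  | insert z Z _ ih =>
    have hup : IsUpperSet {a : V →₀ ℕ | ∃ z ∈ Z, a z ≠ 0} :=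
      fun a b hab ⟨z, hz, ha⟩ => ⟨z, hz, fun hb => ha (Nat.le_zero.1 (hb ▸ hab z))⟩
    convert ih.union_variable (hU.union hup) hr z using 1
    ext a
    simp only [Set.mem_union, Set.mem_ofPred_eq, Finset.mem_insert, Set.mem_Ici,
      Finsupp.single_le_iff, exists_eq_or_imp, Nat.one_le_iff_ne_zero]
    rw [or_assoc, or_comm (a := a z ≠ 0)]

theorem exists_le [Nontrivial K] (h : RegLE K r U) {a : V →₀ ℕ} (ha : a ∈ U) :
    ∃ b ∈ U, b ≤ a ∧ (b.degree : ℤ) ≤ r := by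
  classical
  obtain ⟨ι, _, b, f, hb, hf, -⟩ := h 1
  obtain ⟨hfU, hsurj⟩ := mapFamily_eq_iff.1 hf
  obtain ⟨c, hc, hfc⟩ := hsurj a 1 (mem_monomialFamily.2 fun _ => ha)
  have hsum : ∑ i, f (Pi.single i (c i)) ≠ 0 := by
    rw [← map_sum, Finset.univ_sum_single, hfc]
    exact one_ne_zero
  obtain ⟨i, -, hi⟩ := Finset.exists_ne_zero_of_sum_ne_zero hsum
  have hmem : Pi.single i (c i) ∈ (exponentSystem K V).free b (b i) :=
    mem_free_ofPreorder.2 fun j hj => by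
      obtain rfl := of_not_not fun hji => hj (Pi.single_eq_of_ne hji _)
      exact le_rfl
  have hci : c i ≠ 0 := fun h0 => hi (by rw [h0, Pi.single_zero, map_zero])
  exact ⟨b i, mem_monomialFamily.1 (hfU _ _ hmem) hi, mem_free_ofPreorder.1 hc i hci, hb i⟩

end RegLE

end Exponents

section Squarefree

/-- The exponents of the monomials whose supports belong to `W`: for an upper set `W`, the
squarefree monomial ideal generated by the products over the members of `W`. -/
def supportIn {V : Type*} (W : Set (Finset V)) : Set (V →₀ ℕ) := {a | a.support ∈ W}

theorem mem_supportIn {V : Type*} {W : Set (Finset V)} {a : V →₀ ℕ} :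
    a ∈ supportIn W ↔ a.support ∈ W := Iff.rfl

theorem isUpperSet_supportIn {V : Type*} {W : Set (Finset V)} (hW : IsUpperSet W) :
    IsUpperSet (supportIn W) :=
  fun _ _ hab ha => hW (Finsupp.support_mono hab) ha

variable {V : Type*} [DecidableEq V] {W : Set (Finset V)}

/-- Each nonempty member of `W` contains a pair that belongs to `W`: apart from the unit ideal, the
squarefree ideal of `W` is generated in degrees at most two. The two elements may coincide. -/
def QuadraticallyGenerated (W : Set (Finset V)) : Prop :=
  ∀ A ∈ W, A.Nonempty → ∃ p ∈ A, ∃ q ∈ A, {p, q} ∈ W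

theorem supportIn_insert (x : V) :
    supportIn {A | insert x A ∈ W} = {a | a + Finsupp.single x 1 ∈ supportIn W} := by
  have hsupp (a : V →₀ ℕ) : (a + Finsupp.single x 1).support = insert x a.support := by
    ext v
    by_cases h : v = x <;> simp [h]
  simp only [supportIn, Set.mem_ofPred_eq, hsupp]

theorem supportIn_sdiff (N : Finset V) :
    supportIn {A | A \ N ∈ W} = {a | a.filter (· ∉ N) ∈ supportIn W} := by
  ext a
  simp only [supportIn, Set.mem_ofPred_eq, Finsupp.support_filter, Finset.filter_notMem_eq_sdiff]

omit [DecidableEq V] in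
theorem single_add_single_le_iff {x y : V} (hxy : x ≠ y) {a : V →₀ ℕ} :
    Finsupp.single x 1 + Finsupp.single y 1 ≤ a ↔ x ∈ a.support ∧ y ∈ a.support := by
  classical
  simp only [Finsupp.mem_support_iff, ← Nat.one_le_iff_ne_zero]
  refine ⟨fun h => ⟨by simpa [hxy] using h x, by simpa [hxy.symm] using h y⟩, fun h v => ?_⟩
  obtain rfl | hvx := eq_or_ne v x
  · simpa [hxy] using h.1
  · obtain rfl | hvy := eq_or_ne v y
    · simpa [hvx] using h.2
    · simp [hvx, hvy]

theorem isUpperSet_insert_mem (hW : IsUpperSet W) (x : V) :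
    IsUpperSet {A : Finset V | insert x A ∈ W} :=
  fun _ _ h hA => hW (Finset.insert_subset_insert _ h) hA

theorem isUpperSet_sdiff_mem (hW : IsUpperSet W) (N : Finset V) :
    IsUpperSet {A : Finset V | A \ N ∈ W} :=
  fun _ _ h hA => hW (Finset.sdiff_subset_sdiff h le_rfl) hA

namespace QuadraticallyGenerated

theorem mem_iff (hq : QuadraticallyGenerated W) (hW : IsUpperSet W) (h0 : ∅ ∉ W) {A : Finset V} :
    A ∈ W ↔ ∃ p ∈ A, ∃ q ∈ A, {p, q} ∈ W := by
  refine ⟨fun hA => hq A hA (Finset.nonempty_iff_ne_empty.2 fun h => h0 (h ▸ hA)), ?_⟩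
  rintro ⟨p, hp, q, hq, hpq⟩
  exact hW (Finset.insert_subset hp (Finset.singleton_subset_iff.2 hq)) hpq

theorem exists_of_insert_mem (hq : QuadraticallyGenerated W) (hW : IsUpperSet W) {x : V}
    {A : Finset V} (hA : A.Nonempty) (hxA : insert x A ∈ W) :
    (∃ p ∈ A, ∃ q ∈ A, {p, q} ∈ W) ∨ ∃ q ∈ A, {x, q} ∈ W := by
  obtain ⟨p, hp, q, hq, hpq⟩ := hq _ hxA (Finset.insert_nonempty x A)
  rw [Finset.mem_insert] at hp hq
  obtain rfl | hp := hp
  · obtain rfl | hq := hq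
    · obtain ⟨q, hqA⟩ := hA
      exact Or.inr ⟨q, hqA, hW (by simp) hpq⟩
    · exact Or.inr ⟨q, hq, hpq⟩
  · obtain rfl | hq := hq
    · exact Or.inr ⟨p, hp, Finset.pair_comm p q ▸ hpq⟩
    · exact Or.inl ⟨p, hp, q, hq, hpq⟩

theorem inter_colon (hq : QuadraticallyGenerated W) (hW : IsUpperSet W) (x y : V) :
    QuadraticallyGenerated {A | insert x A ∈ W ∧ insert y A ∈ W} := by
  rintro A ⟨hx, hy⟩ hA
  obtain ⟨p, hp, q, hq, hpq⟩ | ⟨p, hp, hxp⟩ := hq.exists_of_insert_mem hW hA hx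
  · exact ⟨p, hp, q, hq, hW (Finset.subset_insert _ _) hpq, hW (Finset.subset_insert _ _) hpq⟩
  obtain ⟨p, hp, q, hq, hpq⟩ | ⟨q, hq, hyq⟩ := hq.exists_of_insert_mem hW hA hy
  · exact ⟨p, hp, q, hq, hW (Finset.subset_insert _ _) hpq, hW (Finset.subset_insert _ _) hpq⟩
  · refine ⟨p, hp, q, hq, hW ?_ hxp, hW ?_ hyq⟩ <;> intro v <;> simp <;> tauto

section Neighbors

variable {x y : V} {N : Finset V} (hW : IsUpperSet W) (hq : QuadraticallyGenerated W)
  (hxy : {x, y} ∈ W) (hx : {x} ∉ W) (hy : {y} ∉ W)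
  (hN : ∀ p, p ∈ N ↔ p ≠ x ∧ p ≠ y ∧ ({p, x} ∈ W ∨ {p, y} ∈ W))

include hW hq hxy hx hy hN

theorem sdiff_mem_iff (A : Finset V) :
    A \ N ∈ W ↔ A \ (N ∪ {x, y}) ∈ W ∨ (x ∈ A ∧ y ∈ A) := by
  have h0 : ∅ ∉ W := fun h => hx (hW (Finset.empty_subset _) h)
  obtain ⟨P, hP⟩ : ∃ P : V → V → Prop, ∀ p q, {p, q} ∈ W ↔ P p q := ⟨_, fun _ _ => Iff.rfl⟩
  have hsymm (p q : V) : P p q ↔ P q p := by rw [← hP, ← hP, Finset.pair_comm]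
  rw [← Finset.pair_eq_singleton, hP] at hx hy
  simp only [hP, hq.mem_iff hW h0, Finset.mem_sdiff, Finset.mem_union, Finset.mem_insert,
    Finset.mem_singleton] at hxy hN ⊢
  clear hP hq hW h0
  grind

theorem insert_mem_or_iff (A : Finset V) :
    (insert x A ∈ W ∨ insert y A ∈ W) ↔ A \ (N ∪ {x, y}) ∈ W ∨ ∃ z ∈ N ∪ {x, y}, z ∈ A := by
  have h0 : ∅ ∉ W := fun h => hx (hW (Finset.empty_subset _) h)
  obtain ⟨P, hP⟩ : ∃ P : V → V → Prop, ∀ p q, {p, q} ∈ W ↔ P p q := ⟨_, fun _ _ => Iff.rfl⟩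
  have hsymm (p q : V) : P p q ↔ P q p := by rw [← hP, ← hP, Finset.pair_comm]
  rw [← Finset.pair_eq_singleton, hP] at hx hy
  simp only [hP, hq.mem_iff hW h0, Finset.mem_sdiff, Finset.mem_union, Finset.mem_insert,
    Finset.mem_singleton] at hxy hN ⊢
  clear hP hq hW h0
  grind

end Neighbors

end QuadraticallyGenerated

namespace RegLE

variable {K : Type u} [CommRing K] {r : ℤ} {x y : V} {N : Finset V}

theorem supportIn_sdiff_mem (h : RegLE K r (supportIn W)) (N : Finset V) :
    RegLE K r (supportIn {A | A \ N ∈ W}) := by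
  rw [supportIn_sdiff]
  exact h.filter _

theorem supportIn_insert_mem (h : RegLE K r (supportIn W)) (x : V) :
    RegLE K r (supportIn {A | insert x A ∈ W}) := by
  rw [supportIn_insert]
  exact h.colon _

/-- Deleting an edge together with its neighbourhood lowers the regularity: if `H` is the ideal that
remains, then both `H` and `H + (x * y)` are obtained from `W` by deleting variables. -/
theorem sub_one_sdiff_mem (hr : 2 ≤ r) (hW : IsUpperSet W) (hq : QuadraticallyGenerated W)
    (hxy : {x, y} ∈ W) (hx : {x} ∉ W) (hy : {y} ∉ W)
    (hN : ∀ p, p ∈ N ↔ p ≠ x ∧ p ≠ y ∧ ({p, x} ∈ W ∨ {p, y} ∈ W)) (h : RegLE K r (supportIn W)) :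
    RegLE K (r - 1) (supportIn {A | A \ (N ∪ {x, y}) ∈ W}) := by
  have hne : x ≠ y := by
    rintro rfl
    exact hx (by simpa using hxy)
  let c : V →₀ ℕ := Finsupp.single x 1 + Finsupp.single y 1
  have hc : ((c.degree : ℕ) : ℤ) = 2 := by simp [c]
  let H : Set (V →₀ ℕ) := supportIn {A | A \ (N ∪ {x, y}) ∈ W}
  have hsup : RegLE K r (H ∪ Set.Ici c) := by
    convert h.supportIn_sdiff_mem N using 1
    ext a
    simp only [H, Set.mem_union, Set.mem_Ici, c, single_add_single_le_iff hne, mem_supportIn]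
    exact (hq.sdiff_mem_iff hW hxy hx hy hN a.support).symm
  have hinf : RegLE K (r - 1 + c.degree) (H ∩ Set.Ici c) :=
    inter (isUpperSet_supportIn (isUpperSet_sdiff_mem hW _)) (isUpperSet_Ici c)
      ((h.supportIn_sdiff_mem _).mono (by lia)) (Ici (by lia)) (hsup.mono (by lia))
  have hHc (a : V →₀ ℕ) : (a - c).support \ (N ∪ {x, y}) = a.support \ (N ∪ {x, y}) := by
    ext v
    simp only [Finset.mem_sdiff, Finset.mem_union, Finset.mem_insert, Finset.mem_singleton, not_or]
    refine and_congr_left fun hv => ?_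
    simp [c, hv.2.1, hv.2.2]
  rw [← shift_iff (c := c)]
  convert hinf using 1
  ext a
  simp only [H, Set.mem_inter_iff, mem_supportIn, Set.mem_ofPred_eq, hHc, Set.mem_Ici, and_comm]

theorem inter_colon [Finite V] (hr : 2 ≤ r)
    (hW : IsUpperSet W) (hq : QuadraticallyGenerated W) {x y : V} (hxy : {x, y} ∈ W)
    (h : RegLE K r (supportIn W)) :
    RegLE K r (supportIn {A | insert x A ∈ W ∧ insert y A ∈ W}) := by
  classical
  cases nonempty_fintype V
  have hmem {z : V} (hz : {z} ∈ W) (A : Finset V) : insert z A ∈ W :=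
    hW (Finset.singleton_subset_iff.2 (Finset.mem_insert_self z A)) hz
  by_cases hx : {x} ∈ W
  · simpa only [hmem hx, true_and] using h.supportIn_insert_mem y
  by_cases hy : {y} ∈ W
  · simpa only [hmem hy, and_true] using h.supportIn_insert_mem x
  let N : Finset V := {p | p ≠ x ∧ p ≠ y ∧ ({p, x} ∈ W ∨ {p, y} ∈ W)}
  have hN (p : V) : p ∈ N ↔ p ≠ x ∧ p ≠ y ∧ ({p, x} ∈ W ∨ {p, y} ∈ W) := by simp [N]
  refine inter (isUpperSet_supportIn (isUpperSet_insert_mem hW x))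
    (isUpperSet_supportIn (isUpperSet_insert_mem hW y)) (h.supportIn_insert_mem x)
    (h.supportIn_insert_mem y) ?_
  convert (sub_one_sdiff_mem hr hW hq hxy hx hy hN h).union_variables
    (isUpperSet_supportIn (isUpperSet_sdiff_mem hW _)) (by lia) (N ∪ {x, y}) using 1
  ext a
  simp only [Set.mem_union, mem_supportIn, Set.mem_ofPred_eq, ← Finsupp.mem_support_iff]
  exact hq.insert_mem_or_iff hW hxy hx hy hN a.support

end RegLE

end Squarefree

section Exchange

variable {V : Type*}

/-- Exchange property of a product of ideals generated by variables: the triples `(w, p, q)` encode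
two products of variables `∏ p` and `∏ q`, where `p` and `q` belong to the factor of `w`. -/
theorem exists_exchange [DecidableEq V] (R : V → V → Prop) (t : Multiset (V × V × V))
    (hR : ∀ x ∈ t, R x.1 x.2.1 ∧ R x.1 x.2.2) (a : V)
    (ha : (t.map fun x => x.2.2).count a < (t.map fun x => x.2.1).count a) :
    ∃ b, (t.map fun x => x.2.1).count b < (t.map fun x => x.2.2).count b ∧
      ∃ t' : Multiset (V × V), t'.map Prod.fst = t.map Prod.fst ∧ (∀ x ∈ t', R x.1 x.2) ∧
        b ::ₘ t'.map Prod.snd = a ::ₘ t.map fun x => x.2.2 := by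
  induction hn : t.card generalizing t a with
  | zero =>
    rw [Multiset.card_eq_zero] at hn
    simp [hn] at ha
  | succ n ih =>
    obtain ⟨⟨w, p, c⟩, hx, rfl⟩ : ∃ x ∈ t, x.2.1 = a :=
      Multiset.mem_map.1 (Multiset.count_pos.1 (Nat.zero_lt_of_lt ha))
    obtain ⟨t, rfl⟩ := Multiset.exists_cons_of_mem hx
    rw [Multiset.card_cons, Nat.succ_inj] at hn
    simp only [Multiset.mem_cons, forall_eq_or_imp] at hR
    simp only [Multiset.map_cons, Multiset.count_cons] at ha ⊢
    by_cases hc : (t.map fun x => x.2.1).count c + (if c = p then 1 else 0) <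
        (t.map fun x => x.2.2).count c + 1
    · refine ⟨c, by simpa using hc, (w, p) ::ₘ t.map fun x => (x.1, x.2.2), by simp, ?_, ?_⟩
      · exact Multiset.forall_mem_cons.2
          ⟨hR.1.1, Multiset.forall_mem_map_iff.2 fun x hx => (hR.2 x hx).2⟩
      · simp [Multiset.cons_swap c p]
    · obtain ⟨b, hb, t', ht', hR', heq⟩ := ih t hR.2 c (by grind) hn
      refine ⟨b, by grind, (w, p) ::ₘ t', by simp [ht'], by simpa [hR.1.1] using hR', ?_⟩
      rw [Multiset.map_cons, Multiset.cons_swap, heq]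

theorem exists_triples {l l' : Multiset (V × V)} (h : l'.map Prod.fst = l.map Prod.fst) :
    ∃ t : Multiset (V × V × V), t.map (fun x => (x.1, x.2.1)) = l' ∧
      t.map (fun x => (x.1, x.2.2)) = l := by
  rw [← Multiset.rel_eq, Multiset.rel_map] at h
  induction h with
  | zero => exact ⟨0, rfl, rfl⟩
  | @cons a b as bs hab _ ih =>
    obtain ⟨t, rfl, rfl⟩ := ih
    refine ⟨(a.1, a.2, b.2) ::ₘ t, by simp, ?_⟩
    rw [Multiset.map_cons, hab]

end Exchange

section EdgeSums

variable {V : Type*}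

/-- The exponent of the product of the edges in `l`. -/
noncomputable def edgeSum (l : Multiset (V × V)) : V →₀ ℕ :=
  (l.map fun p => Finsupp.single p.1 1 + Finsupp.single p.2 1).sum

theorem edgeSum_cons (p : V × V) (l : Multiset (V × V)) :
    edgeSum (p ::ₘ l) = Finsupp.single p.1 1 + Finsupp.single p.2 1 + edgeSum l := by
  simp [edgeSum]

theorem degree_edgeSum (l : Multiset (V × V)) : (edgeSum l).degree = 2 * l.card := by
  induction l using Multiset.induction_on with
  | empty => simp [edgeSum]
  | cons p l ih =>
    simp only [edgeSum_cons, map_add, ih, Finsupp.degree_single, Multiset.card_cons]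
    ring

theorem edgeSum_apply [DecidableEq V] (l : Multiset (V × V)) (v : V) :
    edgeSum l v = (l.map Prod.fst).count v + (l.map Prod.snd).count v := by
  induction l using Multiset.induction_on with
  | empty => simp [edgeSum]
  | cons p l ih =>
    simp only [edgeSum_cons, Finsupp.add_apply, ih, Multiset.map_cons, Multiset.count_cons,
      Finsupp.single_apply, eq_comm (a := v)]
    ring

theorem count_fst_of_oriented [DecidableEq V] {C : Finset V} {l : Multiset (V × V)}
    (hl : ∀ p ∈ l, p.1 ∈ C ∧ p.2 ∉ C) (v : V) :
    (l.map Prod.fst).count v = if v ∈ C then edgeSum l v else 0 := by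
  split_ifs with hv
  · rw [edgeSum_apply, Multiset.count_eq_zero_of_notMem (s := l.map Prod.snd), add_zero]
    intro h
    obtain ⟨p, hp, rfl⟩ := Multiset.mem_map.1 h
    exact (hl p hp).2 hv
  · refine Multiset.count_eq_zero_of_notMem fun h => ?_
    obtain ⟨p, hp, rfl⟩ := Multiset.mem_map.1 h
    exact hv (hl p hp).1

variable {G : SimpleGraph V}

theorem sum_edgeSum [DecidableEq V] {C : Finset V} (hC : G.IsVertexCover ↑C)
    {l : Multiset (V × V)} (hl : ∀ p ∈ l, G.Adj p.1 p.2) :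
    ∑ v ∈ C, edgeSum l v = l.card + l.countP fun p => p.1 ∈ C ∧ p.2 ∈ C := by
  induction l using Multiset.induction_on with
  | empty => simp [edgeSum]
  | cons p l ih =>
    rw [Multiset.forall_mem_cons] at hl
    have hp : p.1 ∈ C ∨ p.2 ∈ C := hC hl.1
    simp only [edgeSum_cons, Finsupp.add_apply, Finset.sum_add_distrib, ih hl.2,
      Multiset.card_cons, Multiset.countP_cons, Finsupp.single_apply, Finset.sum_ite_eq]
    split_ifs <;> grind

theorem exists_oriented {C : Finset V} (hC : G.IsVertexCover ↑C) {l : Multiset (V × V)}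
    (hl : ∀ p ∈ l, G.Adj p.1 p.2) (hlC : ∀ p ∈ l, ¬(p.1 ∈ C ∧ p.2 ∈ C)) :
    ∃ l' : Multiset (V × V), l'.card = l.card ∧ edgeSum l' = edgeSum l ∧
      (∀ p ∈ l', G.Adj p.1 p.2) ∧ ∀ p ∈ l', p.1 ∈ C ∧ p.2 ∉ C := by
  classical
  refine ⟨l.map fun p => if p.1 ∈ C then p else p.swap, Multiset.card_map _ _, ?_, ?_, ?_⟩
  · simp only [edgeSum, Multiset.map_map, Function.comp_apply]
    refine congrArg _ (Multiset.map_congr rfl fun p _ => ?_)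
    split_ifs
    · rfl
    · exact add_comm _ _
  · refine Multiset.forall_mem_map_iff.2 fun p hp => ?_
    split_ifs
    · exact hl p hp
    · exact (hl p hp).symm
  · refine Multiset.forall_mem_map_iff.2 fun p hp => ?_
    split_ifs with h
    · exact ⟨h, fun h' => hlC p hp ⟨h, h'⟩⟩
    · exact ⟨(hC (hl p hp)).resolve_left h, h⟩

theorem exists_edgeSum_exchange_of_map_fst_eq {k k' : Multiset (V × V)}
    (hk : ∀ p ∈ k, G.Adj p.1 p.2) (hk' : ∀ p ∈ k', G.Adj p.1 p.2)
    (hfst : k'.map Prod.fst = k.map Prod.fst) {z : V} (hz : edgeSum k z < edgeSum k' z) :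
    ∃ w, edgeSum k' w < edgeSum k w ∧ ∃ m : Multiset (V × V), m.card = k.card ∧
      (∀ p ∈ m, G.Adj p.1 p.2) ∧
      edgeSum m + Finsupp.single w 1 = edgeSum k + Finsupp.single z 1 := by
  classical
  have hlt {v : V} {j j' : Multiset (V × V)} (hj : j'.map Prod.fst = j.map Prod.fst) :
      edgeSum j v < edgeSum j' v ↔ (j.map Prod.snd).count v < (j'.map Prod.snd).count v := by
    rw [edgeSum_apply, edgeSum_apply, hj, Nat.add_lt_add_iff_left]
  rw [hlt hfst] at hz
  simp only [hlt hfst.symm]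
  obtain ⟨t, rfl, rfl⟩ := exists_triples hfst
  rw [Multiset.map_map, Multiset.map_map] at hz
  rw [Multiset.forall_mem_map_iff] at hk hk'
  obtain ⟨w, hw, m, hm, hR, hcons⟩ := exists_exchange (fun x y => G.Adj x y) t
    (fun x hx => ⟨hk' x hx, hk x hx⟩) z hz
  refine ⟨w, by simpa only [Multiset.map_map, Function.comp_def] using hw, m, ?_, hR, ?_⟩
  · simpa using congrArg Multiset.card hm
  · ext v
    have hsnd := congrArg (Multiset.count v) hcons
    simp only [Multiset.count_cons, eq_comm (a := v)] at hsnd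
    simp only [Finsupp.add_apply, edgeSum_apply, hm, Multiset.map_map, Function.comp_def,
      Finsupp.single_apply]
    lia

end EdgeSums

section Covers

variable {V : Type*} (G : SimpleGraph V)

/-- Minimal vertex covers. -/
def IsMinimalCover (C : Finset V) : Prop := Minimal (fun C : Finset V => G.IsVertexCover ↑C) C

/-- The exponents of the monomials in the `t`-th symbolic power of the edge ideal. -/
def symbolicExponents (t : ℕ) : Set (V →₀ ℕ) :=
  {a | ∀ C, IsMinimalCover G C → t ≤ ∑ v ∈ C, a v}

/-- The exponents of the monomials in the edge ideal. -/
def edgeExponents : Set (V →₀ ℕ) := {a | ∃ v w, G.Adj v w ∧ a v ≠ 0 ∧ a w ≠ 0}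

/-- The exponents of the products of `s` edges. -/
def edgeProducts (s : ℕ) : Set (V →₀ ℕ) :=
  {m | ∃ l : Multiset (V × V), l.card = s ∧ (∀ p ∈ l, G.Adj p.1 p.2) ∧ edgeSum l = m}

/-- The sets of vertices that meet all minimal vertex covers that contain just one vertex of each
edge in `l`: they describe the colon of the symbolic power by the product of the edges in `l`. -/
def transversals (l : Multiset (V × V)) : Set (Finset V) :=
  {A | ∀ C, IsMinimalCover G C → (∀ p ∈ l, ¬(p.1 ∈ C ∧ p.2 ∈ C)) → ∃ v ∈ A, v ∈ C}

variable {G}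

theorem isUpperSet_symbolicExponents (t : ℕ) : IsUpperSet (symbolicExponents G t) :=
  fun _ _ h ha C hC => (ha C hC).trans (Finset.sum_le_sum fun v _ => h v)

theorem isUpperSet_transversals (l : Multiset (V × V)) : IsUpperSet (transversals G l) := by
  intro A B h hA C hC hl
  obtain ⟨v, hv, hvC⟩ := hA C hC hl
  exact ⟨v, h hv, hvC⟩

theorem exists_isMinimalCover_subset {C : Finset V} (hC : G.IsVertexCover ↑C) :
    ∃ D ⊆ C, IsMinimalCover G D :=
  exists_minimal_le_of_wellFoundedLT (fun C : Finset V => G.IsVertexCover ↑C) C hC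

theorem sum_pos_iff {C : Finset V} {a : V →₀ ℕ} :
    0 < ∑ v ∈ C, a v ↔ ∃ v ∈ a.support, v ∈ C := by
  simp only [Finset.sum_pos_iff, Finsupp.mem_support_iff, Nat.pos_iff_ne_zero, and_comm]

theorem add_edgeSum_mem_symbolicExponents {l : Multiset (V × V)} (hl : ∀ p ∈ l, G.Adj p.1 p.2)
    {a : V →₀ ℕ} : a + edgeSum l ∈ symbolicExponents G (l.card + 1) ↔
      a ∈ supportIn (transversals G l) := by
  classical
  refine forall_congr' fun C => forall_congr' fun hC => ?_
  rw [← sum_pos_iff, ← Multiset.countP_eq_zero]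
  simp only [Finsupp.add_apply, Finset.sum_add_distrib, sum_edgeSum hC.1 hl]
  lia

theorem transversals_cons [DecidableEq V] (p : V × V) (l : Multiset (V × V)) :
    transversals G (p ::ₘ l) =
      {A | insert p.1 A ∈ transversals G l ∧ insert p.2 A ∈ transversals G l} := by
  ext A
  simp only [transversals, Set.mem_ofPred_eq, Multiset.forall_mem_cons,
    Finset.exists_mem_insert, ← forall_and]
  exact forall_congr' fun C => forall_congr' fun _ => by tauto

theorem pair_mem_transversals [DecidableEq V] {x y : V} (h : G.Adj x y) (l : Multiset (V × V)) :
    {x, y} ∈ transversals G l := by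
  intro C hC _
  obtain h | h := hC.1 h
  exacts [⟨x, by simp, h⟩, ⟨y, by simp, h⟩]

theorem mem_transversals_zero_iff [Finite V] {A : Finset V} :
    A ∈ transversals G 0 ↔ ∃ v ∈ A, ∃ w ∈ A, G.Adj v w := by
  classical
  cases nonempty_fintype V
  constructor
  · intro h
    by_contra! hA
    have hcover : G.IsVertexCover ↑Aᶜ := fun v w hvw => by
      rw [Finset.mem_coe, Finset.mem_coe, Finset.mem_compl, Finset.mem_compl, ← not_and_or]
      exact fun hc => hA v hc.1 w hc.2 hvw
    obtain ⟨D, hDA, hD⟩ := exists_isMinimalCover_subset hcover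
    obtain ⟨v, hv, hvD⟩ := h D hD (by simp)
    exact Finset.mem_compl.1 (hDA hvD) hv
  · rintro ⟨v, hv, w, hw, hvw⟩
    exact isUpperSet_transversals 0 (Finset.insert_subset hv (Finset.singleton_subset_iff.2 hw))
      (pair_mem_transversals hvw 0)

theorem supportIn_transversals_zero [Finite V] :
    supportIn (transversals G 0) = edgeExponents G := by
  ext a
  simp only [mem_supportIn, mem_transversals_zero_iff, edgeExponents, Set.mem_ofPred_eq,
    Finsupp.mem_support_iff]
  grind

theorem quadraticallyGenerated_transversals [Finite V] [DecidableEq V] (l : Multiset (V × V)) :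
    QuadraticallyGenerated (transversals G l) := by
  induction l using Multiset.induction_on with
  | empty =>
    intro A hA _
    obtain ⟨v, hv, w, hw, hvw⟩ := mem_transversals_zero_iff.1 hA
    exact ⟨v, hv, w, hw, pair_mem_transversals hvw 0⟩
  | cons p l ih =>
    rw [transversals_cons]
    exact ih.inter_colon (isUpperSet_transversals l) _ _

theorem regLE_supportIn_transversals [Finite V] {K : Type u} [CommRing K] {ρ : ℤ} (hρ : 2 ≤ ρ)
    (h : RegLE K ρ (edgeExponents G)) {l : Multiset (V × V)} (hl : ∀ p ∈ l, G.Adj p.1 p.2) :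
    RegLE K ρ (supportIn (transversals G l)) := by
  classical
  induction l using Multiset.induction_on with
  | empty => rwa [supportIn_transversals_zero]
  | cons p l ih =>
    rw [Multiset.forall_mem_cons] at hl
    rw [transversals_cons]
    exact RegLE.inter_colon hρ (isUpperSet_transversals l) (quadraticallyGenerated_transversals l)
      (pair_mem_transversals hl.1 l) (ih hl.2)

theorem edgeExponents_eq_upperClosure : edgeExponents G = upperClosure (edgeProducts G 1) := by
  ext a
  simp only [edgeExponents, edgeProducts, Multiset.card_eq_one, SetLike.mem_coe,
    mem_upperClosure, Set.mem_ofPred_eq, ← Finsupp.mem_support_iff]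
  constructor
  · rintro ⟨v, w, h, ha⟩
    exact ⟨_, ⟨{(v, w)}, ⟨_, rfl⟩, by simpa using h, rfl⟩,
      by simpa [edgeSum] using (single_add_single_le_iff h.ne).2 ha⟩
  · rintro ⟨_, ⟨_, ⟨⟨v, w⟩, rfl⟩, h, rfl⟩, hle⟩
    have hvw : G.Adj v w := by simpa using h
    exact ⟨v, w, hvw, (single_add_single_le_iff hvw.ne).1 (by simpa [edgeSum] using hle)⟩

theorem two_le_of_regLE_edgeExponents {K : Type u} [CommRing K] [Nontrivial K] {r : ℤ} {v w : V}
    (h : G.Adj v w) (hr : RegLE K r (edgeExponents G)) : 2 ≤ r := by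
  rw [edgeExponents_eq_upperClosure] at hr
  have hmem : edgeSum {(v, w)} ∈ edgeProducts G 1 := ⟨_, rfl, by simpa using h, rfl⟩
  obtain ⟨b, ⟨_, ⟨l, hl, -, rfl⟩, hlb⟩, -, hb⟩ := hr.exists_le (subset_upperClosure hmem)
  have := Finsupp.degree_mono hlb
  rw [degree_edgeSum, hl] at this
  lia

theorem finite_edgeProducts [Finite V] (s : ℕ) : (edgeProducts G s).Finite := by
  refine (Finsupp.finite_of_degree_eq (σ := V) (2 * s)).subset ?_
  rintro _ ⟨l, rfl, -, rfl⟩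
  exact degree_edgeSum l

end Covers

section LexDescent

variable {V : Type*} {G : SimpleGraph V}

theorem exists_edgeProducts_exchange {C : Finset V} (hC : G.IsVertexCover ↑C)
    {l l' : Multiset (V × V)} (hl : ∀ p ∈ l, G.Adj p.1 p.2) (hl' : ∀ p ∈ l', G.Adj p.1 p.2)
    (hlC : ∀ p ∈ l, ¬(p.1 ∈ C ∧ p.2 ∈ C)) (hlC' : ∀ p ∈ l', ¬(p.1 ∈ C ∧ p.2 ∈ C))
    (heq : ∀ v ∈ C, edgeSum l' v = edgeSum l v) {z : V} (hz : edgeSum l z < edgeSum l' z) :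
    ∃ w, edgeSum l' w < edgeSum l w ∧ ∃ m ∈ edgeProducts G l.card,
      m + Finsupp.single w 1 = edgeSum l + Finsupp.single z 1 := by
  classical
  obtain ⟨k, hcard, hsum, hk, hkC⟩ := exists_oriented hC hl hlC
  obtain ⟨k', -, hsum', hk', hkC'⟩ := exists_oriented hC hl' hlC'
  have hfst : k'.map Prod.fst = k.map Prod.fst := by
    ext v
    rw [count_fst_of_oriented hkC, count_fst_of_oriented hkC', hsum, hsum']
    split_ifs with hv
    exacts [heq v hv, rfl]
  rw [← hsum, ← hsum'] at hz ⊢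
  obtain ⟨w, hw, m, hm, hmG, hmw⟩ := exists_edgeSum_exchange_of_map_fst_eq hk hk' hfst hz
  exact ⟨w, hw, edgeSum m, ⟨m, hm.trans hcard, hmG, rfl⟩, hmw⟩

theorem exists_isMinimalCover_of_le_add {l l' : Multiset (V × V)}
    (hl : ∀ p ∈ l, G.Adj p.1 p.2) (hl' : ∀ p ∈ l', G.Adj p.1 p.2) (hcard : l'.card = l.card)
    {a : V →₀ ℕ} (ha : a + edgeSum l ∉ symbolicExponents G (l.card + 1))
    (hle : edgeSum l' ≤ a + edgeSum l) :
    ∃ C, IsMinimalCover G C ∧ (∀ p ∈ l, ¬(p.1 ∈ C ∧ p.2 ∈ C)) ∧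
      (∀ p ∈ l', ¬(p.1 ∈ C ∧ p.2 ∈ C)) ∧ ∀ v ∈ C, edgeSum l' v = edgeSum l v := by
  classical
  simp only [symbolicExponents, Set.mem_ofPred_eq, not_forall, not_le] at ha
  obtain ⟨C, hC, hlt⟩ := ha
  have hsum := sum_edgeSum hC.1 hl
  have hsum' := sum_edgeSum hC.1 hl'
  have hsum_le : ∑ v ∈ C, edgeSum l' v ≤ ∑ v ∈ C, (a + edgeSum l) v :=
    Finset.sum_le_sum fun v _ => hle v
  simp only [Finsupp.add_apply, Finset.sum_add_distrib] at hlt hsum_le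
  have ha0 : ∀ v ∈ C, a v = 0 := by
    rw [← Finset.sum_eq_zero_iff]
    lia
  have hleC : ∀ v ∈ C, edgeSum l' v ≤ edgeSum l v := fun v hv => by
    simpa [ha0 v hv] using hle v
  exact ⟨C, hC, Multiset.countP_eq_zero.1 (by lia), Multiset.countP_eq_zero.1 (by lia),
    (Finset.sum_eq_sum_iff_of_le hleC).1 (by lia)⟩

variable [LinearOrder V]

theorem toLex_lt_of_add_single_eq {b m : V →₀ ℕ} {z w : V} (hzw : z < w)
    (h : m + Finsupp.single w 1 = b + Finsupp.single z 1) : toLex b < toLex m := by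
  have happ (v : V) := DFunLike.congr_fun h v
  simp only [Finsupp.add_apply] at happ
  refine Finsupp.Lex.lt_iff.2 ⟨z, fun v hv => ?_, ?_⟩
  · simpa [Finsupp.single_apply, hv.ne', (hv.trans hzw).ne'] using (happ v).symm
  · have hz := happ z
    rw [Finsupp.single_eq_of_ne hzw.ne, Finsupp.single_eq_same] at hz
    exact Nat.lt_of_succ_le hz.ge

theorem exists_lex_larger_edgeProduct {l l' : Multiset (V × V)}
    (hl : ∀ p ∈ l, G.Adj p.1 p.2) (hl' : ∀ p ∈ l', G.Adj p.1 p.2) (hcard : l'.card = l.card)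
    (hlex : toLex (edgeSum l) < toLex (edgeSum l')) {a : V →₀ ℕ}
    (ha : a + edgeSum l ∉ symbolicExponents G (l.card + 1)) (hle : edgeSum l' ≤ a + edgeSum l) :
    ∃ z, a z ≠ 0 ∧ ∃ m ∈ edgeProducts G l.card, toLex (edgeSum l) < toLex m ∧
      m ≤ edgeSum l + Finsupp.single z 1 := by
  obtain ⟨C, hC, hlC, hlC', heq⟩ := exists_isMinimalCover_of_le_add hl hl' hcard ha hle
  obtain ⟨z, hz, hzlt⟩ := Finsupp.Lex.lt_iff.1 hlex
  change edgeSum l z < edgeSum l' z at hzlt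
  obtain ⟨w, hw, m, hm, hmw⟩ := exists_edgeProducts_exchange hC.1 hl hl' hlC hlC' heq hzlt
  have hzw : z < w := by
    rcases lt_trichotomy z w with h | rfl | h
    · exact h
    · exact absurd hw hzlt.asymm
    · exact absurd (hz w h) hw.ne'
  refine ⟨z, fun h0 => ?_, m, hm, toLex_lt_of_add_single_eq hzw hmw, hmw ▸ le_self_add⟩
  have := hle z
  rw [Finsupp.add_apply, h0, zero_add] at this
  exact this.not_gt hzlt

/-- The products of as many edges as `l` has that are lexicographically larger than that of `l`. -/
def lexLarger (G : SimpleGraph V) (l : Multiset (V × V)) : Set (V →₀ ℕ) :=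
  {m ∈ edgeProducts G l.card | toLex (edgeSum l) < toLex m}

-- The colon ideals that arise when the products of `s` edges are added in lexicographic order to
-- the symbolic power differ from those of the symbolic power by variables only.
theorem add_edgeSum_mem_union_iff {l : Multiset (V × V)} (hl : ∀ p ∈ l, G.Adj p.1 p.2)
    {a : V →₀ ℕ} :
    a + edgeSum l ∈ symbolicExponents G (l.card + 1) ∪ upperClosure (lexLarger G l) ↔
      a ∈ supportIn (transversals G l) ∪
        {a | ∃ z, edgeSum l + Finsupp.single z 1 ∈ upperClosure (lexLarger G l) ∧ a z ≠ 0} := by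
  rw [Set.mem_union, Set.mem_union, add_edgeSum_mem_symbolicExponents hl]
  constructor
  · rintro (h | ⟨_, ⟨⟨l', hcard, hl', rfl⟩, hlex⟩, hle⟩)
    · exact Or.inl h
    rw [← add_edgeSum_mem_symbolicExponents hl]
    by_cases ha : a + edgeSum l ∈ symbolicExponents G (l.card + 1)
    · exact Or.inl ha
    obtain ⟨z, hz, m, hm, hlt, hmz⟩ := exists_lex_larger_edgeProduct hl hl' hcard hlex ha hle
    exact Or.inr ⟨z, ⟨m, ⟨hm, hlt⟩, hmz⟩, hz⟩
  · rintro (h | ⟨z, hz, haz⟩)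
    · exact Or.inl h
    · refine Or.inr ((upperClosure _).upper ?_ hz)
      rw [add_comm]
      gcongr
      exact Finsupp.single_le_iff.2 (Nat.one_le_iff_ne_zero.2 haz)

variable [Finite V] {K : Type u} [CommRing K] {ρ r : ℤ}

theorem regLE_union_lexLarger (hρ : 2 ≤ ρ) {l : Multiset (V × V)}
    (hr : ρ + 2 * l.card ≤ r) (hl : ∀ p ∈ l, G.Adj p.1 p.2)
    (hG : RegLE K ρ (edgeExponents G))
    (h : RegLE K r (symbolicExponents G (l.card + 1) ∪
      upperClosure (insert (edgeSum l) (lexLarger G l)))) :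
    RegLE K r (symbolicExponents G (l.card + 1) ∪ upperClosure (lexLarger G l)) := by
  classical
  cases nonempty_fintype V
  have hdeg : ((edgeSum l).degree : ℤ) = 2 * l.card := by simp [degree_edgeSum]
  refine RegLE.left_of_union_of_inter
    ((isUpperSet_symbolicExponents _).union (upperClosure _).upper)
    (isUpperSet_Ici (edgeSum l)) ?_ ?_ (RegLE.Ici (by lia))
  · rwa [Set.union_assoc, Set.union_comm _ (Set.Ici _), ← UpperSet.coe_Ici,
      ← upperClosure_singleton, ← UpperSet.coe_inf, ← upperClosure_union, ← Set.insert_eq]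
  · let Z := Finset.univ.filter fun z =>
      edgeSum l + Finsupp.single z 1 ∈ upperClosure (lexLarger G l)
    have hcolon := (regLE_supportIn_transversals hρ hG hl).union_variables
      (isUpperSet_supportIn (isUpperSet_transversals l)) (by lia) Z
    rw [← RegLE.shift_iff (c := edgeSum l), hdeg] at hcolon
    refine RegLE.mono ?_ hr
    convert hcolon using 1
    ext a
    rw [Set.mem_inter_iff, Set.mem_Ici, and_comm, Set.mem_ofPred_eq]
    refine and_congr_right fun ha => ?_
    conv_lhs => rw [← tsub_add_cancel_of_le ha, add_edgeSum_mem_union_iff hl]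
    simp [Z]

end LexDescent

theorem descending_induction {α β : Type*} [LinearOrder β] {f : α → β}
    (hf : Function.Injective f) {T : Set α} (hT : T.Finite) {P : Set α → Prop}
    (hstep : ∀ x ∈ T, P (insert x {y ∈ T | f x < f y}) → P {y ∈ T | f x < f y}) (h : P T) :
    P ∅ := by
  classical
  obtain ⟨T, rfl⟩ := hT.exists_finset_coe
  suffices ∀ S : Finset α, S ⊆ T → (∀ x ∈ S, ∀ y ∈ T, f x < f y → y ∈ S) → P ↑S → P ∅ from
    this T subset_rfl (fun _ _ _ hy _ => hy) h
  intro S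
  induction S using Finset.induction_on_min_value f with
  | empty => simp
  | insert x S hx hmin ih =>
    intro hST hup hP
    have hlt (y) (hy : y ∈ S) : f x < f y :=
      (hmin y hy).lt_of_ne fun h => hx (hf h ▸ hy)
    have hmem (y) (hy : y ∈ T) (hxy : f x < f y) : y ∈ S :=
      (Finset.mem_insert.1 (hup x (Finset.mem_insert_self x S) y hy hxy)).resolve_left
        fun h => hxy.ne (h ▸ rfl)
    have hS : (S : Set α) = {y ∈ (T : Set α) | f x < f y} := by
      ext y
      exact ⟨fun hy => ⟨hST (Finset.mem_insert_of_mem hy), hlt y hy⟩, fun hy => hmem y hy.1 hy.2⟩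
    refine ih (fun y hy => hST (Finset.mem_insert_of_mem hy))
      (fun y hy z hz hyz => hmem z hz ((hlt y hy).trans hyz)) ?_
    rw [Finset.coe_insert, hS] at hP
    rw [hS]
    exact hstep x (hST (Finset.mem_insert_self x S)) hP

theorem regLE_symbolicExponents {V : Type*} [Finite V] {G : SimpleGraph V} {K : Type u}
    [CommRing K] {ρ r : ℤ} {s : ℕ} (hρ : 2 ≤ ρ) (hr : ρ + 2 * s ≤ r)
    (hG : RegLE K ρ (edgeExponents G))
    (h : RegLE K r (symbolicExponents G (s + 1) ∪ upperClosure (edgeProducts G s))) :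
    RegLE K r (symbolicExponents G (s + 1)) := by
  cases nonempty_fintype V
  let _ : LinearOrder V := LinearOrder.lift' (Fintype.equivFin V) (Equiv.injective _)
  have hdescent := descending_induction
    (P := fun S => RegLE K r (symbolicExponents G (s + 1) ∪ upperClosure S))
    (toLex (α := V →₀ ℕ)).injective (finite_edgeProducts (G := G) s) ?_ h
  · simpa using hdescent
  · rintro _ ⟨l, rfl, hl, rfl⟩ hins
    exact regLE_union_lexLarger hρ hr hl hG hins

open MvPolynomial HomSystem

section Graded

variable {K : Type u} {V : Type v} [Field K]

theorem mem_polyComponent {j : ℤ} {p : MvPolynomial V K} :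
    p ∈ polyComponent K V j ↔ ∀ a, coeff a p ≠ 0 → (a.degree : ℤ) = j := by
  simp only [polyComponent, mem_restrictSupport_iff, ← mem_support_iff]
  rfl

variable (K V) in
/-- The standard graded polynomial ring as a system of homomorphism groups: the elements that act
from degree `i` to degree `j` are the homogeneous polynomials of degree `j - i`. -/
noncomputable def gradedSystem : HomSystem (MvPolynomial V K) ℤ where
  deg := id
  comp i j := (polyComponent K V (j - i)).toAddSubgroup
  one_mem j := by
    classical
    simp only [sub_self, Submodule.mem_toAddSubgroup, mem_polyComponent, coeff_one]
    intro a ha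
    rw [← (ite_ne_right_iff.1 ha).1, map_zero, Nat.cast_zero]
  mul_mem {i j k p q} hp hq := by
    classical
    simp only [Submodule.mem_toAddSubgroup, mem_polyComponent] at hp hq ⊢
    intro c hc
    rw [coeff_mul] at hc
    obtain ⟨x, hx, hne⟩ := Finset.exists_ne_zero_of_sum_ne_zero hc
    have hx₁ := hp _ (left_ne_zero_of_mul hne)
    have hx₂ := hq _ (right_ne_zero_of_mul hne)
    rw [← Finset.HasAntidiagonal.mem_antidiagonal.1 hx, map_add]
    lia

variable {ι κ : Type*} {e : ι → ℤ} {e' : κ → ℤ}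

theorem mem_gradedSystem_free {j : ℤ} {x : ι → MvPolynomial V K} :
    x ∈ (gradedSystem K V).free e j ↔ ∀ i a, coeff a (x i) ≠ 0 → (a.degree : ℤ) + e i = j := by
  simp only [mem_free, gradedSystem, Submodule.mem_toAddSubgroup, mem_polyComponent,
    eq_sub_iff_add_eq]

/-- The projection of a graded free module to its component of degree `j`. -/
noncomputable def freeProj (e : ι → ℤ) (j : ℤ) :
    (ι → MvPolynomial V K) →ₗ[K] (ι → MvPolynomial V K) :=
  LinearMap.pi fun i =>
    (if 0 ≤ j - e i then homogeneousComponent (j - e i).toNat else 0) ∘ₗ LinearMap.proj i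

theorem coeff_freeProj (e : ι → ℤ) (j : ℤ) (x : ι → MvPolynomial V K) (i : ι) (a : V →₀ ℕ) :
    coeff a (freeProj e j x i) = if (a.degree : ℤ) + e i = j then coeff a (x i) else 0 := by
  simp only [freeProj, LinearMap.pi_apply, LinearMap.comp_apply, LinearMap.proj_apply]
  split_ifs with h₁ h₂ h₂
  · rw [coeff_homogeneousComponent, if_pos (by lia)]
  · rw [coeff_homogeneousComponent, if_neg (by lia)]
  · lia
  · simp

theorem freeProj_mem (e : ι → ℤ) (j : ℤ) (x : ι → MvPolynomial V K) :
    freeProj e j x ∈ (gradedSystem K V).free e j := by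
  simp only [mem_gradedSystem_free, coeff_freeProj, ite_ne_right_iff]
  exact fun _ _ h => h.1

theorem freeProj_of_mem {j k : ℤ} {x : ι → MvPolynomial V K}
    (hx : x ∈ (gradedSystem K V).free e k) : freeProj e j x = if j = k then x else 0 := by
  rw [mem_gradedSystem_free] at hx
  funext i
  ext a
  rw [coeff_freeProj, apply_ite (fun y : ι → MvPolynomial V K => coeff a (y i)), Pi.zero_apply,
    coeff_zero]
  by_cases ha : coeff a (x i) = 0
  · simp only [ha, ite_self]
  · simp only [hx i a ha, eq_comm (a := j)]

theorem eq_sum_freeProj [Finite ι] (e : ι → ℤ) (x : ι → MvPolynomial V K) :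
    ∃ T : Finset ℤ, x = ∑ j ∈ T, freeProj e j x := by
  classical
  cases nonempty_fintype ι
  refine ⟨Finset.univ.biUnion fun i => (x i).support.image fun a => (a.degree : ℤ) + e i, ?_⟩
  funext i
  ext a
  simp only [Finset.sum_apply, coeff_sum, coeff_freeProj, Finset.sum_ite_eq]
  split_ifs with h
  · rfl
  · by_contra ha
    exact h (Finset.mem_biUnion.2 ⟨i, Finset.mem_univ i,
      Finset.mem_image_of_mem _ (mem_support_iff.2 ha)⟩)

theorem mem_of_forall_freeProj_mem [Finite ι] {H : AddSubgroup (ι → MvPolynomial V K)}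
    {x : ι → MvPolynomial V K} (h : ∀ j, freeProj e j x ∈ H) : x ∈ H := by
  obtain ⟨T, hT⟩ := eq_sum_freeProj e x
  rw [hT]
  exact sum_mem fun j _ => h j

variable {f : (ι → MvPolynomial V K) →ₗ[MvPolynomial V K] (κ → MvPolynomial V K)}

theorem map_freeProj [Finite ι]
    (hf : ∀ j, ∀ x ∈ (gradedSystem K V).free e j, f x ∈ (gradedSystem K V).free e' j) (j : ℤ)
    (x : ι → MvPolynomial V K) : f (freeProj e j x) = freeProj e' j (f x) := by
  suffices x ∈ (f.toAddMonoidHom.comp (freeProj e j).toAddMonoidHom).eqLocus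
      ((freeProj e' j).toAddMonoidHom.comp f.toAddMonoidHom) from this
  refine mem_of_forall_freeProj_mem (e := e) fun k => ?_
  have hk := freeProj_mem e k x
  change f (freeProj e j (freeProj e k x)) = freeProj e' j (f (freeProj e k x))
  rw [freeProj_of_mem hk, freeProj_of_mem (hf k _ hk), apply_ite f, map_zero]

theorem exists_homogeneous_preimage [Finite ι]
    (hf : ∀ j, ∀ x ∈ (gradedSystem K V).free e j, f x ∈ (gradedSystem K V).free e' j) {j : ℤ}
    {x : ι → MvPolynomial V K} (hx : f x ∈ (gradedSystem K V).free e' j) :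
    ∃ y ∈ (gradedSystem K V).free e j, f y = f x :=
  ⟨freeProj e j x, freeProj_mem e j x, by rw [map_freeProj hf, freeProj_of_mem hx, if_pos rfl]⟩

end Graded

section Realize

variable {K : Type u} {V : Type v} [Field K] {ι κ : Type*}

/-- The coefficient of the monomial with exponent `a` in a vector of polynomials. -/
noncomputable def coeffVec (a : V →₀ ℕ) : (κ → MvPolynomial V K) →ₗ[K] (κ → K) :=
  LinearMap.pi fun k => lcoeff K a ∘ₗ LinearMap.proj k

/-- The vector of polynomials with the single coefficient `c`, at the monomial with exponent `a`. -/
noncomputable def monomialVec (a : V →₀ ℕ) : (κ → K) →ₗ[K] (κ → MvPolynomial V K) :=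
  LinearMap.pi fun k => monomial a ∘ₗ LinearMap.proj k

theorem coeffVec_apply (a : V →₀ ℕ) (x : κ → MvPolynomial V K) (k : κ) :
    coeffVec a x k = coeff a (x k) := rfl

theorem monomialVec_apply (a : V →₀ ℕ) (c : κ → K) (k : κ) :
    monomialVec a c k = monomial a (c k) := rfl

theorem coeffVec_monomialVec (a b : V →₀ ℕ) (c : κ → K) [Decidable (b = a)] :
    coeffVec a (monomialVec b c) = if b = a then c else 0 := by
  classical
  funext k
  rw [coeffVec_apply, monomialVec_apply, coeff_monomial]
  split_ifs <;> rfl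

theorem ext_coeffVec {x y : κ → MvPolynomial V K} (h : ∀ a, coeffVec a x = coeffVec a y) :
    x = y := by
  funext k
  ext a
  exact congrFun (h a) k

theorem finite_coeffVec_ne_zero [Finite κ] (x : κ → MvPolynomial V K) :
    {a | coeffVec a x ≠ 0}.Finite := by
  refine (Set.finite_iUnion fun k => (x k).support.finite_toSet).subset fun a ha => ?_
  obtain ⟨k, hk⟩ := Function.ne_iff.1 ha
  exact Set.mem_iUnion.2 ⟨k, mem_support_iff.2 hk⟩

theorem eq_sum_monomialVec [Finite κ] (x : κ → MvPolynomial V K) :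
    x = ∑ a ∈ (finite_coeffVec_ne_zero x).toFinset, monomialVec a (coeffVec a x) := by
  classical
  refine ext_coeffVec fun a => ?_
  simp only [map_sum, coeffVec_monomialVec, Finset.sum_ite_eq', Set.Finite.mem_toFinset,
    Set.mem_ofPred_eq, ite_not]
  split_ifs with h
  · exact h
  · rfl

/-- The graded components, for the standard grading, of the module over the polynomial ring whose
multigraded components are `N`. -/
noncomputable def realize (N : (V →₀ ℕ) → AddSubgroup (κ → K)) (j : ℤ) :
    AddSubgroup (κ → MvPolynomial V K) :=
  ⨅ a : V →₀ ℕ, (if (a.degree : ℤ) = j then N a else ⊥).comap (coeffVec a).toAddMonoidHom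

theorem mem_realize {N : (V →₀ ℕ) → AddSubgroup (κ → K)} {j : ℤ} {x : κ → MvPolynomial V K} :
    x ∈ realize N j ↔ ∀ a, coeffVec a x ∈ N a ∧ (coeffVec a x ≠ 0 → (a.degree : ℤ) = j) := by
  simp only [realize, AddSubgroup.mem_iInf, AddSubgroup.mem_comap]
  refine forall_congr' fun a => ?_
  change coeffVec a x ∈ _ ↔ _
  split_ifs with h
  · simp [h]
  · rw [AddSubgroup.mem_bot]
    exact ⟨fun h0 => by simp [h0, zero_mem],
      fun hx => not_not.1 fun hne => h (hx.2 hne)⟩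

theorem monomialVec_mem_realize {N : (V →₀ ℕ) → AddSubgroup (κ → K)} {a : V →₀ ℕ} {c : κ → K}
    (hc : c ∈ N a) : monomialVec a c ∈ realize N a.degree := by
  classical
  refine mem_realize.2 fun b => ?_
  rw [coeffVec_monomialVec]
  split_ifs with h
  · exact ⟨h ▸ hc, fun _ => by rw [h]⟩
  · exact ⟨zero_mem _, fun hne => absurd rfl hne⟩

theorem realize_le [Finite κ] {N : (V →₀ ℕ) → AddSubgroup (κ → K)} {j : ℤ}
    {H : AddSubgroup (κ → MvPolynomial V K)}
    (h : ∀ a : V →₀ ℕ, (a.degree : ℤ) = j → ∀ c ∈ N a, monomialVec a c ∈ H) : realize N j ≤ H := by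
  intro x hx
  rw [eq_sum_monomialVec x]
  refine sum_mem fun a ha => h a ?_ _ (mem_realize.1 hx a).1
  exact (mem_realize.1 hx a).2 ((Set.Finite.mem_toFinset _).1 ha)

theorem coeffVec_smul [DecidableEq V] (p : MvPolynomial V K) (x : κ → MvPolynomial V K)
    (a : V →₀ ℕ) : coeffVec a (p • x) =
      ∑ d ∈ Finset.HasAntidiagonal.antidiagonal a, coeff d.1 p • coeffVec d.2 x := by
  funext k
  simp [coeffVec_apply, coeff_mul]

theorem stable_realize {N : (V →₀ ℕ) → AddSubgroup (κ → K)} (hN : (exponentSystem K V).Stable N) :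
    (gradedSystem K V).Stable (realize N) := by
  classical
  intro i j p x hp hx
  rw [gradedSystem, Submodule.mem_toAddSubgroup, mem_polyComponent] at hp
  rw [mem_realize] at hx ⊢
  intro a
  rw [coeffVec_smul]
  constructor
  · refine sum_mem fun d hd => hN (mem_comp_ofPreorder.2 fun _ => ?_) (hx d.2).1
    exact (Finset.HasAntidiagonal.mem_antidiagonal.1 hd).le.trans' le_add_self
  · intro hne
    obtain ⟨d, hd, hne⟩ := Finset.exists_ne_zero_of_sum_ne_zero hne
    have h₁ := hp _ (left_ne_zero_of_smul hne)
    have h₂ := (hx d.2).2 (right_ne_zero_of_smul hne)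
    rw [← Finset.HasAntidiagonal.mem_antidiagonal.1 hd, map_add]
    lia

/-- Multiplication of the `i`-th coordinate by the monomial with exponent `b i`. -/
noncomputable def mulMonomials (K : Type*) [Field K] (b : ι → V →₀ ℕ) :
    (ι → MvPolynomial V K) →ₗ[MvPolynomial V K] (ι → MvPolynomial V K) :=
  LinearMap.pi fun i => monomial (b i) (1 : K) • LinearMap.proj i

theorem mulMonomials_apply (b : ι → V →₀ ℕ) (x : ι → MvPolynomial V K) (i : ι) :
    mulMonomials K b x i = monomial (b i) 1 * x i := rfl

theorem mulMonomials_injective (b : ι → V →₀ ℕ) : Function.Injective (mulMonomials K b) := by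
  intro x y h
  funext i
  ext a
  have hi := congrArg (coeff (b i + a)) (congrFun h i)
  simpa only [mulMonomials_apply, coeff_monomial_mul, one_mul] using hi

theorem mapFamily_mulMonomials [Finite ι] (b : ι → V →₀ ℕ) :
    mapFamily ((gradedSystem K V).free fun i => ((b i).degree : ℤ)) (mulMonomials K b) =
      realize ((exponentSystem K V).free b) := by
  classical
  refine funext fun j => le_antisymm ?_ (realize_le fun a ha c hc => ?_)
  · rintro _ ⟨x, hx, rfl⟩
    replace hx := mem_gradedSystem_free.1 hx
    have hcoeff (a : V →₀ ℕ) (i : ι) (hne : coeffVec a (mulMonomials K b x) i ≠ 0) :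
        b i ≤ a ∧ (a.degree : ℤ) = j := by
      rw [coeffVec_apply, mulMonomials_apply, coeff_monomial_mul', one_mul,
        ite_ne_right_iff] at hne
      obtain ⟨d, rfl⟩ := exists_add_of_le hne.1
      rw [add_tsub_cancel_left] at hne
      have := hx i d hne.2
      rw [map_add]
      exact ⟨hne.1, by lia⟩
    refine mem_realize.2 fun a => ⟨mem_free_ofPreorder.2 fun i hi => (hcoeff a i hi).1, ?_⟩
    intro hne
    obtain ⟨i, hi⟩ := Function.ne_iff.1 hne
    exact (hcoeff a i hi).2
  · rw [mem_free_ofPreorder] at hc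
    refine ⟨fun i => monomial (a - b i) (c i), mem_gradedSystem_free.2 fun i d hd => ?_, ?_⟩
    · rw [coeff_monomial, ite_ne_right_iff] at hd
      rw [← hd.1, ← ha, ← Nat.cast_add, ← map_add, tsub_add_cancel_of_le (hc i hd.2)]
    · refine funext fun i => ?_
      change monomial (b i) (1 : K) * monomial (a - b i) (c i) = monomial a (c i)
      rw [monomial_mul, one_mul]
      by_cases hi : c i = 0
      · simp [hi]
      · rw [add_tsub_cancel_of_le (hc i hi)]

variable [Fintype ι]

open Classical in
/-- The extension of scalars of a linear map from `K` to the polynomial ring. -/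
noncomputable def extendScalars (V : Type*) (f : (ι → K) →ₗ[K] (κ → K)) :
    (ι → MvPolynomial V K) →ₗ[MvPolynomial V K] (κ → MvPolynomial V K) :=
  ((LinearMap.toMatrix' f).map C).mulVecLin

theorem coeffVec_extendScalars (f : (ι → K) →ₗ[K] (κ → K)) (x : ι → MvPolynomial V K)
    (a : V →₀ ℕ) : coeffVec a (extendScalars V f x) = f (coeffVec a x) := by
  classical
  funext k
  rw [← LinearMap.toMatrix'_mulVec f]
  change coeff a (∑ i, C (LinearMap.toMatrix' f k i) * x i) =
    ∑ i, LinearMap.toMatrix' f k i * coeffVec a x i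
  simp only [coeff_sum, coeff_C_mul, coeffVec_apply]

theorem extendScalars_monomialVec (f : (ι → K) →ₗ[K] (κ → K)) (a : V →₀ ℕ) (c : ι → K) :
    extendScalars V f (monomialVec a c) = monomialVec a (f c) := by
  classical
  refine ext_coeffVec fun b => ?_
  rw [coeffVec_extendScalars, coeffVec_monomialVec, coeffVec_monomialVec, apply_ite f, map_zero]

theorem mapFamily_extendScalars [Finite κ] (N : (V →₀ ℕ) → AddSubgroup (ι → K))
    (f : (ι → K) →ₗ[K] (κ → K)) :
    mapFamily (realize N) (extendScalars V f) = realize (mapFamily N f) := by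
  refine funext fun j => le_antisymm ?_ (realize_le ?_)
  · rintro _ ⟨x, hx, rfl⟩
    refine mem_realize.2 fun a => ?_
    change coeffVec a (extendScalars V f x) ∈ _ ∧ (coeffVec a (extendScalars V f x) ≠ 0 → _)
    rw [coeffVec_extendScalars]
    exact ⟨⟨_, (mem_realize.1 hx a).1, rfl⟩,
      fun hne => (mem_realize.1 hx a).2 fun h0 => hne (by rw [h0, map_zero])⟩
  · rintro a rfl _ ⟨c, hc, rfl⟩
    exact ⟨_, monomialVec_mem_realize hc, extendScalars_monomialVec f a c⟩

theorem kerFamily_extendScalars (N : (V →₀ ℕ) → AddSubgroup (ι → K))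
    (f : (ι → K) →ₗ[K] (κ → K)) :
    kerFamily (realize N) (extendScalars V f) = realize (kerFamily N f) := by
  have hker (x : ι → MvPolynomial V K) :
      extendScalars V f x = 0 ↔ ∀ a, f (coeffVec a x) = 0 := by
    simp only [← coeffVec_extendScalars]
    exact ⟨fun h a => by rw [h, map_zero], fun h => ext_coeffVec fun a => by rw [h, map_zero]⟩
  ext j x
  simp only [mem_kerFamily, mem_realize, hker, and_right_comm, ← forall_and]

theorem mapFamily_extendScalars_comp_mulMonomials [Finite κ] (b : ι → V →₀ ℕ)
    (f : (ι → K) →ₗ[K] (κ → K)) :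
    mapFamily ((gradedSystem K V).free fun i => ((b i).degree : ℤ))
        (extendScalars V f ∘ₗ mulMonomials K b) =
      realize (mapFamily ((exponentSystem K V).free b) f) := by
  rw [mapFamily_comp, mapFamily_mulMonomials, mapFamily_extendScalars]

theorem mapFamily_kerFamily_mulMonomials (b : ι → V →₀ ℕ) (f : (ι → K) →ₗ[K] (κ → K)) :
    mapFamily (kerFamily ((gradedSystem K V).free fun i => ((b i).degree : ℤ))
        (extendScalars V f ∘ₗ mulMonomials K b)) (mulMonomials K b) =
      realize (kerFamily ((exponentSystem K V).free b) f) := by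
  rw [mapFamily_kerFamily_comp, mapFamily_mulMonomials, kerFamily_extendScalars]

end Realize

section Multigraded

variable {K : Type u} {V : Type v} [Field K] {κ : Type}
  {N : (V →₀ ℕ) → AddSubgroup (κ → K)} {n : ℕ} {r : ℤ}

/-- The multigraded components of the generators of a multigraded module generate it. -/
theorem exists_multigraded_cover [Finite κ] (hN : (exponentSystem K V).Stable N) {ι : Type}
    [Finite ι] {e : ι → ℤ} (he : ∀ i, e i ≤ r)
    {f : (ι → MvPolynomial V K) →ₗ[MvPolynomial V K] (κ → MvPolynomial V K)}
    (hf : mapFamily ((gradedSystem K V).free e) f = realize N) :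
    ∃ (m : ℕ) (b : Fin m → V →₀ ℕ) (g : (Fin m → K) →ₗ[K] (κ → K)),
      (∀ k, ((b k).degree : ℤ) ≤ r) ∧ mapFamily ((exponentSystem K V).free b) g = N := by
  classical
  cases nonempty_fintype ι
  let x (i : ι) : κ → MvPolynomial V K := f (Pi.single i 1)
  have hx (i : ι) : x i ∈ realize N (e i) := by
    rw [← hf]
    exact ⟨_, single_mem_free e i, rfl⟩
  have (i : ι) : Finite {a // coeffVec a (x i) ≠ 0} := finite_coeffVec_ne_zero (x i)
  obtain ⟨m, ⟨ε⟩⟩ := Finite.exists_equiv_fin (Σ i, {a // coeffVec a (x i) ≠ 0})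
  let b (k : Fin m) : V →₀ ℕ := (ε.symm k).2
  let y (k : Fin m) : κ → K := coeffVec (b k) (x (ε.symm k).1)
  let g := Fintype.linearCombination K y
  let M := mapFamily ((exponentSystem K V).free b) g
  have hM (s : Σ i, {a // coeffVec a (x i) ≠ 0}) : coeffVec s.2 (x s.1) ∈ M s.2 := by
    obtain ⟨k, rfl⟩ := ε.symm.surjective s
    exact ⟨_, single_mem_free b k, by simp [g, y, b, Fintype.linearCombination_apply_single]⟩
  have hxM (i : ι) : x i ∈ realize M (e i) := by
    refine mem_realize.2 fun a => ⟨?_, (mem_realize.1 (hx i) a).2⟩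
    by_cases ha : coeffVec a (x i) = 0
    · rw [ha]
      exact zero_mem _
    · exact hM ⟨i, a, ha⟩
  have hle (j : ℤ) : realize N j ≤ realize M j := by
    rw [← hf]
    rintro _ ⟨c, hc, rfl⟩
    have hfx : f = Fintype.linearCombination (MvPolynomial V K) x :=
      LinearMap.pi_ext' fun i => LinearMap.ext_ring (by simp [x])
    rw [hfx]
    exact linearCombination_mem (stable_realize ((stable_free b).map g)) hxM hc
  refine ⟨m, b, g, fun k => ?_, funext fun a => le_antisymm ?_ fun c hc => ?_⟩
  · exact ((mem_realize.1 (hx _) _).2 (ε.symm k).2.2).trans_le (he _)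
  · rintro _ ⟨c, hc, rfl⟩
    exact linearCombination_mem hN (fun k => (mem_realize.1 (hx _) _).1) hc
  · have := (mem_realize.1 (hle _ (monomialVec_mem_realize hc)) a).1
    rwa [coeffVec_monomialVec, if_pos rfl] at this

theorem resolved_kerFamily_extendScalars_iff {ι : Type} [Fintype ι] (b : ι → V →₀ ℕ)
    (f : (ι → K) →ₗ[K] (κ → K)) :
    (gradedSystem K V).Resolved n r (kerFamily ((gradedSystem K V).free fun i => ((b i).degree : ℤ))
        (extendScalars V f ∘ₗ mulMonomials K b)) ↔
      (gradedSystem K V).Resolved n r (realize (kerFamily ((exponentSystem K V).free b) f)) := by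
  rw [← mapFamily_kerFamily_mulMonomials, resolved_mapFamily_iff (mulMonomials_injective b)]

theorem resolved_realize_iff [Finite κ] (hN : (exponentSystem K V).Stable N) :
    (gradedSystem K V).Resolved n r (realize N) ↔ (exponentSystem K V).Resolved n r N := by
  induction n generalizing r κ with
  | zero => exact Iff.rfl
  | succ n ih =>
    constructor
    · intro h
      have ⟨ι, _, e, f, he, hf, _⟩ := h
      obtain ⟨m, b, g, hb, rfl⟩ := exists_multigraded_cover hN he hf
      refine ⟨Fin m, inferInstance, b, g, hb, rfl, (ih ((stable_free b).ker g)).1 ?_⟩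
      rw [← resolved_kerFamily_extendScalars_iff]
      refine (shortExact_kerFamily _ _).resolved_left (stable_free _)
        (resolved_free (fun i => (hb i).trans (lt_add_one r).le) n) ?_
      rwa [mapFamily_extendScalars_comp_mulMonomials, add_sub_cancel_right]
    · rintro ⟨ι, _, b, g, hb, rfl, hK⟩
      exact ⟨ι, inferInstance, _, _, hb, mapFamily_extendScalars_comp_mulMonomials b g,
        (resolved_kerFamily_extendScalars_iff b g).2 ((ih ((stable_free b).ker g)).2 hK)⟩

end Multigraded

section MonomialIdeal

variable {K : Type u} {V : Type v} [Field K]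

/-- The graded components of an ideal of the polynomial ring, as a family of subgroups. -/
noncomputable def idealFamily (I : Ideal (MvPolynomial V K)) (j : ℤ) : AddSubgroup I :=
  (idealComponent I j).toAddSubgroup

/-- The inclusion of an ideal of the polynomial ring in the free module of rank one. -/
noncomputable def idealToFree (I : Ideal (MvPolynomial V K)) :
    I →ₗ[MvPolynomial V K] (Fin 1 → MvPolynomial V K) :=
  LinearMap.pi fun _ => I.subtype

theorem idealToFree_injective (I : Ideal (MvPolynomial V K)) :
    Function.Injective (idealToFree I) :=
  fun _ _ h => Subtype.ext (congrFun h 0)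

theorem mem_idealFamily {I : Ideal (MvPolynomial V K)} {j : ℤ} {x : I} :
    x ∈ idealFamily I j ↔ idealToFree I x ∈ (gradedSystem K V).free (fun _ => 0) j := by
  rw [mem_gradedSystem_free]
  change (x : MvPolynomial V K) ∈ polyComponent K V j ↔ _
  simp only [mem_polyComponent, add_zero]
  exact ⟨fun h _ => h, fun h => h 0⟩

variable {U : Set (V →₀ ℕ)} {hU : IsUpperSet U}

theorem mem_restrictSupportIdeal {p : MvPolynomial V K} :
    p ∈ restrictSupportIdeal K U hU ↔ ∀ a, coeff a p ≠ 0 → a ∈ U := by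
  change p ∈ restrictSupport K U ↔ _
  simp only [mem_restrictSupport_iff, ← mem_support_iff]
  rfl

theorem mapFamily_idealToFree : mapFamily (idealFamily (restrictSupportIdeal K U hU))
      (idealToFree _) =
    realize (mapFamily (monomialFamily K U)
      (LinearEquiv.funUnique (Fin 1) K K).symm.toLinearMap) := by
  have mem_iff (j : ℤ) (x : Fin 1 → MvPolynomial V K) :
      x ∈ realize (mapFamily (monomialFamily K U)
          (LinearEquiv.funUnique (Fin 1) K K).symm.toLinearMap) j ↔
        x 0 ∈ restrictSupportIdeal K U hU ∧ x 0 ∈ polyComponent K V j := by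
    rw [mem_realize, mem_restrictSupportIdeal, mem_polyComponent, ← forall_and]
    refine forall_congr' fun a => and_congr ?_ (imp_congr_left ?_)
    · rw [← coeffVec_apply, ← mem_monomialFamily]
      exact ⟨fun ⟨_, hc, hcx⟩ => hcx ▸ hc, fun hc =>
        ⟨_, hc, funext fun k => congrArg (coeffVec a x) (Subsingleton.elim 0 k)⟩⟩
    · simp [Function.ne_iff, coeffVec_apply]
  refine mapFamily_eq_iff.2 ⟨fun j x hx => (mem_iff _ _).2 ⟨x.2, hx⟩, fun j x hx => ?_⟩
  rw [mem_iff] at hx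
  exact ⟨⟨x 0, hx.1⟩, hx.2, funext fun i => congrArg x (Subsingleton.elim 0 i)⟩

theorem regLE_iff_resolved_idealFamily {r : ℤ} (hU : IsUpperSet U) : RegLE K r U ↔
    ∀ n, (gradedSystem K V).Resolved n r (idealFamily (restrictSupportIdeal K U hU)) := by
  refine forall_congr' fun n => ?_
  rw [← resolved_mapFamily_iff (idealToFree_injective _), mapFamily_idealToFree,
    resolved_realize_iff ((stable_monomialFamily hU).map _),
    resolved_mapFamily_iff (LinearEquiv.funUnique (Fin 1) K K).symm.injective]

end MonomialIdeal

section ProjectiveCover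

variable {K : Type u} {V : Type v} [Field K] {r : ℤ} {ι : Type*} {e : ι → ℤ}

theorem constantCoeff_eq_zero_of_mem_free {j : ℤ} {c : ι → MvPolynomial V K}
    (hc : c ∈ (gradedSystem K V).free e j) {i : ι} (hi : e i < j) : constantCoeff (c i) = 0 := by
  by_contra hne
  have := mem_gradedSystem_free.1 hc i 0 hne
  rw [map_zero, Nat.cast_zero, zero_add] at this
  exact hi.ne this

theorem constantCoeff_map_eq_zero [Finite ι] {κ : Type*}
    (f : (ι → MvPolynomial V K) →ₗ[MvPolynomial V K] (κ → MvPolynomial V K))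
    {c : ι → MvPolynomial V K} (hc : ∀ i, constantCoeff (c i) = 0) (k : κ) :
    constantCoeff (f c k) = 0 := by
  classical
  cases nonempty_fintype ι
  rw [LinearMap.pi_apply_eq_sum_univ f c, Finset.sum_apply, map_sum]
  refine Finset.sum_eq_zero fun i _ => ?_
  rw [Pi.smul_apply, smul_eq_mul, map_mul, hc, zero_mul]

/-- A homogeneous surjection from a graded free module to the graded module `N` that is minimal:
its kernel consists of vectors of polynomials without constant term. -/
structure IsProjectiveCover {E : Type*} [AddCommGroup E] [Module (MvPolynomial V K) E]
    (e : ι → ℤ) (N : ℤ → AddSubgroup E)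
    (f : (ι → MvPolynomial V K) →ₗ[MvPolynomial V K] E) : Prop where
  map_eq : mapFamily ((gradedSystem K V).free e) f = N
  minimal : ∀ x, f x = 0 → ∀ i, constantCoeff (x i) = 0

namespace IsProjectiveCover

variable {E : Type (max u v)} [AddCommGroup E] [Module (MvPolynomial V K) E]
  {N : ℤ → AddSubgroup E} {f : (ι → MvPolynomial V K) →ₗ[MvPolynomial V K] E}

/- A basis vector of degree larger than `r` would be congruent, modulo the kernel of the cover, to
a vector without constant terms. -/
theorem degree_le (h : IsProjectiveCover e N f)
    (hN : (gradedSystem K V).Resolved 1 r N) (i : ι) : e i ≤ r := by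
  classical
  by_contra! hi
  obtain ⟨κ, _, b, g, hb, hg, -⟩ := hN
  obtain ⟨l, hl, -⟩ := exists_lift (𝒜 := gradedSystem K V) (b := b)
    (N := (gradedSystem K V).free e) (p := f) (f := g) fun j c hc => by
      rw [h.map_eq, ← hg]
      exact ⟨c, hc, rfl⟩
  obtain ⟨c, hc, hgc : g c = f (Pi.single i 1)⟩ :
      f (Pi.single i 1) ∈ mapFamily ((gradedSystem K V).free b) g (e i) := by
    rw [hg, ← h.map_eq]
    exact ⟨_, single_mem_free e i, rfl⟩
  have hlc : constantCoeff (l c i) = 0 :=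
    constantCoeff_map_eq_zero l
      (fun k => constantCoeff_eq_zero_of_mem_free hc ((hb k).trans_lt hi)) i
  have hsub := h.minimal (Pi.single i 1 - l c)
    (by rw [map_sub, ← hgc, ← hl, LinearMap.comp_apply, sub_self]) i
  rw [Pi.sub_apply, Pi.single_eq_same, map_sub, map_one, hlc, sub_zero] at hsub
  exact one_ne_zero hsub

theorem resolved_ker {ι : Type} [Finite ι] {e : ι → ℤ}
    {f : (ι → MvPolynomial V K) →ₗ[MvPolynomial V K] E} (h : IsProjectiveCover e N f)
    (hN : ∀ n, (gradedSystem K V).Resolved n r N) (n : ℕ) :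
    (gradedSystem K V).Resolved n (r + 1) (kerFamily ((gradedSystem K V).free e) f) := by
  cases nonempty_fintype ι
  refine (shortExact_kerFamily _ f).resolved_left (stable_free e)
    (resolved_free (fun i => (h.degree_le (hN 1) i).trans (lt_add_one r).le) n) ?_
  rw [h.map_eq, add_sub_cancel_right]
  exact hN (n + 1)

end IsProjectiveCover

end ProjectiveCover

section MinimalResolution

variable {K : Type u} {V : Type v} [Field K] {I : Ideal (MvPolynomial V K)} {r : ℤ}

theorem mem_freeComponent {k : ℕ} {e : Fin k → ℤ} {j : ℤ} {x : Fin k → MvPolynomial V K} :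
    x ∈ freeComponent K V e j ↔ x ∈ (gradedSystem K V).free e j :=
  (mem_free (𝒜 := gradedSystem K V)).symm

namespace MinimalGradedFreeResolution

variable (F : MinimalGradedFreeResolution K V I (idealComponent I))

theorem d_mem_free (i : ℕ) (j : ℤ) (x : Fin (F.rank (i + 1)) → MvPolynomial V K)
    (hx : x ∈ (gradedSystem K V).free (F.shift (i + 1)) j) :
    F.d i x ∈ (gradedSystem K V).free (F.shift i) j :=
  mem_freeComponent.1 (F.d_mem i j x (mem_freeComponent.2 hx))

theorem mapFamily_aug :
    mapFamily ((gradedSystem K V).free (F.shift 0)) F.aug = idealFamily I := by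
  have haug (j : ℤ) (x) (hx : x ∈ (gradedSystem K V).free (F.shift 0) j) :
      F.aug x ∈ idealFamily I j := F.aug_mem j x (mem_freeComponent.2 hx)
  refine mapFamily_eq_iff.2 ⟨haug, fun j y hy => ?_⟩
  obtain ⟨x, rfl⟩ := F.aug_surjective y
  obtain ⟨x', hx', h⟩ := exists_homogeneous_preimage (f := idealToFree I ∘ₗ F.aug)
    (fun j x hx => mem_idealFamily.1 (haug j x hx)) (mem_idealFamily.1 hy)
  exact ⟨x', hx', idealToFree_injective I h⟩

variable {F} {E : Type (max u v)} [AddCommGroup E] [Module (MvPolynomial V K) E] {i : ℕ}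
  {f : (Fin (F.rank i) → MvPolynomial V K) →ₗ[MvPolynomial V K] E}

theorem kerFamily_eq_mapFamily_d (h : Function.Exact (F.d i) f) :
    kerFamily ((gradedSystem K V).free (F.shift i)) f =
      mapFamily ((gradedSystem K V).free (F.shift (i + 1))) (F.d i) := by
  rw [eq_comm, mapFamily_eq_iff]
  refine ⟨fun j x hx => ⟨F.d_mem_free i j x hx, h.apply_apply_eq_zero x⟩, fun j y hy => ?_⟩
  obtain ⟨x, rfl⟩ := (h y).1 hy.2
  exact exists_homogeneous_preimage (F.d_mem_free i) hy.1

theorem isProjectiveCover_of_exact (h : Function.Exact (F.d i) f) :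
    IsProjectiveCover (F.shift i) (mapFamily ((gradedSystem K V).free (F.shift i)) f) f where
  map_eq := rfl
  minimal x hx a := by
    obtain ⟨y, rfl⟩ := (h x).1 hx
    exact F.minimal i y a

variable (F)

theorem shift_le_of_resolved (h : ∀ n, (gradedSystem K V).Resolved n r (idealFamily I)) (i : ℕ)
    (a : Fin (F.rank i)) : F.shift i a ≤ r + i := by
  have haug := isProjectiveCover_of_exact F.exact_zero
  have hd (i : ℕ) := isProjectiveCover_of_exact (F.exact_succ i)
  rw [← F.mapFamily_aug] at h
  have him (i : ℕ) : ∀ n, (gradedSystem K V).Resolved n (r + i + 1)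
      (mapFamily ((gradedSystem K V).free (F.shift (i + 1))) (F.d i)) := by
    induction i with
    | zero =>
      rw [← kerFamily_eq_mapFamily_d F.exact_zero, Nat.cast_zero, add_zero]
      exact haug.resolved_ker h
    | succ i ih =>
      rw [← kerFamily_eq_mapFamily_d (F.exact_succ i), Nat.cast_succ, ← add_assoc]
      exact (hd i).resolved_ker ih
  cases i with
  | zero => simpa using haug.degree_le (h 1) a
  | succ i => exact ((hd i).degree_le (him i 1) a).trans_eq (by push_cast; ring)

theorem resolved_of_shift_le (h : ∀ i a, F.shift i a ≤ r + i) (n : ℕ) :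
    (gradedSystem K V).Resolved n r (idealFamily I) := by
  have him (n i : ℕ) : (gradedSystem K V).Resolved n (r + i + 1)
      (mapFamily ((gradedSystem K V).free (F.shift (i + 1))) (F.d i)) := by
    induction n generalizing i with
    | zero => trivial
    | succ n ih =>
      refine ⟨_, inferInstance, _, F.d i, fun a => (h (i + 1) a).trans_eq ?_, rfl, ?_⟩
      · push_cast
        ring
      · rw [kerFamily_eq_mapFamily_d (F.exact_succ i)]
        simpa only [Nat.cast_succ, ← add_assoc] using ih (i + 1)
  cases n with
  | zero => trivial
  | succ n =>
    refine ⟨_, inferInstance, _, F.aug, fun a => (h 0 a).trans_eq (by simp), F.mapFamily_aug, ?_⟩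
    rw [kerFamily_eq_mapFamily_d F.exact_zero]
    simpa using him n 0

end MinimalGradedFreeResolution

end MinimalResolution

theorem exists_irredundant_generators {R M : Type*} [Ring R] [AddCommGroup M] [Module R M]
    {A : Set M} (hA : (Submodule.span R A).FG) :
    ∃ t : Finset M, ↑t ⊆ A ∧ Submodule.span R t = Submodule.span R A ∧
      ∀ x ∈ t, x ∉ Submodule.span R (t \ {x} : Set M) := by
  classical
  obtain ⟨t₀, ht₀, hspan₀⟩ := (Submodule.fg_span_iff_fg_span_finset_subset A).1 hA
  obtain ⟨t, ⟨htA, hspan⟩, hmin⟩ := exists_minimal_of_wellFoundedLT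
    (fun t : Finset M => ↑t ⊆ A ∧ Submodule.span R t = Submodule.span R A) ⟨t₀, ht₀, hspan₀.symm⟩
  refine ⟨t, htA, hspan, fun x hx hxt => ?_⟩
  have herase : ↑(t.erase x) ⊆ A ∧ Submodule.span R (t.erase x : Set M) = Submodule.span R A := by
    rw [Finset.coe_erase, ← hspan, ← Submodule.span_insert_eq_span hxt,
      Set.insert_sdiff_singleton, Set.insert_eq_of_mem (Finset.mem_coe.2 hx)]
    exact ⟨Set.sdiff_subset.trans htA, rfl⟩
  exact Finset.notMem_erase x t (hmin herase (Finset.erase_subset x t) hx)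

section Existence

variable {K : Type u} {V : Type v} [Field K] {κ : Type*} {e' : κ → ℤ}

section

variable {E : Type*} [AddCommGroup E] [Module (MvPolynomial V K) E] {N : ℤ → AddSubgroup E}
  {φ : E →ₗ[MvPolynomial V K] (κ → MvPolynomial V K)}

/- The coefficient of a generator in a relation of the same degree is a constant, which vanishes if
no generator is redundant. -/
theorem constantCoeff_eq_zero_of_irredundant {ι : Type*} [Fintype ι] {e : ι → ℤ} {v : ι → E}
    (hφ : Function.Injective φ)
    (hv : ∀ j, ∀ x ∈ (gradedSystem K V).free e j,
      φ (Fintype.linearCombination _ v x) ∈ (gradedSystem K V).free e' j)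
    {i : ι} (hi : v i ∉ Submodule.span (MvPolynomial V K) (v '' {i}ᶜ))
    {x : ι → MvPolynomial V K} (hx : Fintype.linearCombination _ v x = 0) :
    constantCoeff (x i) = 0 := by
  classical
  by_contra hne
  let y := freeProj e (e i) x
  have hy : Fintype.linearCombination _ v y = 0 := hφ <| by
    have := map_freeProj (f := φ ∘ₗ Fintype.linearCombination _ v) hv (e i) x
    simpa only [LinearMap.comp_apply, hx, map_zero] using this
  have hyi : y i = C (constantCoeff (x i)) := by
    ext a
    rw [coeff_freeProj, coeff_C]
    by_cases ha : a = 0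
    · simp [ha, constantCoeff_eq]
    · rw [if_neg (by simpa [Finsupp.degree_eq_zero_iff] using ha), if_neg (Ne.symm ha)]
  have hunit : IsUnit (y i) := by
    rw [hyi]
    exact (IsUnit.mk0 _ hne).map C
  refine hi ((Submodule.smul_mem_iff_of_isUnit _ hunit).1 ?_)
  rw [Fintype.linearCombination_apply, ← Finset.add_sum_erase _ _ (Finset.mem_univ i)] at hy
  rw [eq_neg_of_add_eq_zero_left hy]
  exact neg_mem (sum_mem fun k hk => Submodule.smul_mem _ _
    (Submodule.subset_span ⟨k, Finset.ne_of_mem_erase hk, rfl⟩))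

theorem exists_isProjectiveCover [IsNoetherian (MvPolynomial V K) E]
    (hN : (gradedSystem K V).Stable N) (hφ : Function.Injective φ)
    (hNφ : ∀ j, ∀ x ∈ N j, φ x ∈ (gradedSystem K V).free e' j) :
    ∃ (k : ℕ) (e : Fin k → ℤ) (f : (Fin k → MvPolynomial V K) →ₗ[MvPolynomial V K] E),
      IsProjectiveCover e N f := by
  obtain ⟨t, htN, hspan, hirr⟩ := exists_irredundant_generators
    (IsNoetherian.noetherian (Submodule.span (MvPolynomial V K) (⋃ j, (N j : Set E))))
  let v (i : Fin t.card) : E := t.equivFin.symm i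
  have hv (i : Fin t.card) : ∃ j, v i ∈ N j := Set.mem_iUnion.1 (htN (t.equivFin.symm i).2)
  choose e he using hv
  have hrange : Set.range v = t := by
    rw [Set.range_comp', t.equivFin.symm.surjective.range_eq]
    simp
  let f := Fintype.linearCombination (MvPolynomial V K) v
  have hfN (j : ℤ) (x) (hx : x ∈ (gradedSystem K V).free e j) : f x ∈ N j :=
    linearCombination_mem hN he hx
  refine ⟨_, e, f, mapFamily_eq_iff.2 ⟨hfN, fun j y hy => ?_⟩, fun x hx i => ?_⟩
  · obtain ⟨x, rfl⟩ : y ∈ LinearMap.range f := by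
      rw [Fintype.range_linearCombination, hrange, hspan]
      exact Submodule.subset_span (Set.mem_iUnion.2 ⟨j, hy⟩)
    obtain ⟨x', hx', h⟩ := exists_homogeneous_preimage (f := φ ∘ₗ f)
      (fun j x hx => hNφ j _ (hfN j x hx)) (hNφ j _ hy)
    exact ⟨x', hx', hφ h⟩
  · refine constantCoeff_eq_zero_of_irredundant hφ (fun j x hx => hNφ j _ (hfN j x hx))
      (fun hi => hirr (v i) (t.equivFin.symm i).2 (Submodule.span_mono ?_ hi)) hx
    rintro _ ⟨k, hk, rfl⟩
    exact ⟨(t.equivFin.symm k).2, fun h => hk (t.equivFin.symm.injective (Subtype.ext h))⟩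

theorem exact_of_mapFamily_eq_kerFamily {ι ι' : Type*} [Finite ι] [Finite ι'] {e : ι → ℤ}
    {e'' : ι' → ℤ}
    {f : (ι → MvPolynomial V K) →ₗ[MvPolynomial V K] E}
    {g : (ι' → MvPolynomial V K) →ₗ[MvPolynomial V K] (ι → MvPolynomial V K)}
    (hφ : Function.Injective φ)
    (hf : ∀ j, ∀ x ∈ (gradedSystem K V).free e j, φ (f x) ∈ (gradedSystem K V).free e' j)
    (h : mapFamily ((gradedSystem K V).free e'') g = kerFamily ((gradedSystem K V).free e) f) :
    Function.Exact g f := by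
  intro x
  refine ⟨fun hx => ?_, ?_⟩
  · refine mem_of_forall_freeProj_mem (H := (LinearMap.range g).toAddSubgroup) (e := e) fun j => ?_
    have hker : freeProj e j x ∈ kerFamily ((gradedSystem K V).free e) f j := by
      refine ⟨freeProj_mem e j x, hφ ?_⟩
      have := map_freeProj (f := φ ∘ₗ f) hf j x
      rwa [LinearMap.comp_apply, LinearMap.comp_apply, hx, map_zero, map_zero, ← map_zero φ] at this
    obtain ⟨y, -, hy⟩ := mem_mapFamily.1 ((congrFun h j).symm ▸ hker)
    exact ⟨y, hy⟩
  · rintro ⟨y, rfl⟩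
    suffices y ∈ (LinearMap.ker (f ∘ₗ g)).toAddSubgroup from this
    refine mem_of_forall_freeProj_mem (e := e'') fun j => ?_
    exact ((congrFun h j).le ⟨_, freeProj_mem e'' j y, rfl⟩).2

end

variable (K V) in
/-- A graded submodule of a graded free module of finite rank. -/
structure GradedSubmodule where
  /-- the rank of the ambient free module -/
  rank : ℕ
  /-- the degrees of the basis vectors of the ambient free module -/
  deg : Fin rank → ℤ
  /-- the graded components -/
  family : ℤ → AddSubgroup (Fin rank → MvPolynomial V K)
  stable : (gradedSystem K V).Stable family
  le_free : ∀ j, family j ≤ (gradedSystem K V).free deg j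

theorem GradedSubmodule.exists_syzygies [Finite V] (s : GradedSubmodule K V) :
    ∃ (t : GradedSubmodule K V) (f : (Fin t.rank → MvPolynomial V K) →ₗ[MvPolynomial V K]
      (Fin s.rank → MvPolynomial V K)), IsProjectiveCover t.deg s.family f ∧
        t.family = kerFamily ((gradedSystem K V).free t.deg) f := by
  obtain ⟨k, e, f, hf⟩ := exists_isProjectiveCover s.stable
    (φ := LinearMap.id) Function.injective_id fun j _ hx => s.le_free j hx
  exact ⟨⟨k, e, _, (stable_free e).ker f, fun _ => inf_le_left⟩, f, hf, rfl⟩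

theorem stable_idealFamily (I : Ideal (MvPolynomial V K)) :
    (gradedSystem K V).Stable (idealFamily I) := by
  intro i j p x hp hx
  rw [mem_idealFamily, map_smul]
  exact stable_free _ hp (mem_idealFamily.1 hx)

theorem surjective_of_mapFamily_eq_idealFamily {I : Ideal (MvPolynomial V K)}
    (hI : ∀ p ∈ I, ∀ n, homogeneousComponent n p ∈ I) {ι : Type*} {e : ι → ℤ}
    {f : (ι → MvPolynomial V K) →ₗ[MvPolynomial V K] I}
    (hf : mapFamily ((gradedSystem K V).free e) f = idealFamily I) : Function.Surjective f := by
  intro x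
  suffices x.1 ∈ (LinearMap.range f).map I.subtype by
    obtain ⟨_, ⟨y, rfl⟩, hy⟩ := this
    exact ⟨y, Subtype.ext hy⟩
  rw [← sum_homogeneousComponent x.1]
  refine sum_mem fun n _ => ⟨⟨_, hI _ x.2 n⟩, ?_, rfl⟩
  have hmem : (⟨_, hI _ x.2 n⟩ : I) ∈ idealFamily I n := mem_polyComponent.2
    fun a (ha : coeff a (homogeneousComponent n x.1) ≠ 0) => by
      rw [coeff_homogeneousComponent, ite_ne_right_iff] at ha
      rw [ha.1]
  rw [← hf] at hmem
  obtain ⟨y, -, hy⟩ := hmem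
  exact ⟨y, hy⟩

theorem nonempty_minimalGradedFreeResolution [Finite V] {I : Ideal (MvPolynomial V K)}
    (hI : ∀ p ∈ I, ∀ n, homogeneousComponent n p ∈ I) :
    Nonempty (MinimalGradedFreeResolution K V I (idealComponent I)) := by
  obtain ⟨k, e, f, hf⟩ := exists_isProjectiveCover (stable_idealFamily I)
    (idealToFree_injective I) fun j _ hx => mem_idealFamily.1 hx
  have hfI := (mapFamily_eq_iff.1 hf.map_eq).1
  choose syzygies cover hcover hker using GradedSubmodule.exists_syzygies (K := K) (V := V)
  let s₀ : GradedSubmodule K V := ⟨k, e, kerFamily ((gradedSystem K V).free e) f,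
    (stable_free e).ker f, fun _ => inf_le_left⟩
  let s (i : ℕ) : GradedSubmodule K V := Nat.rec s₀ (fun _ => syzygies) i
  have hs (i j x) (hx : x ∈ (gradedSystem K V).free (s (i + 1)).deg j) :
      cover (s i) x ∈ (gradedSystem K V).free (s i).deg j :=
    (s i).le_free j ((mapFamily_eq_iff.1 (hcover (s i)).map_eq).1 j x hx)
  have exact_zero : Function.Exact (cover (s 0)) f :=
    exact_of_mapFamily_eq_kerFamily (idealToFree_injective I)
      (fun j x hx => mem_idealFamily.1 (hfI j x hx)) (hcover (s 0)).map_eq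
  have exact_succ (i : ℕ) : Function.Exact (cover (s (i + 1))) (cover (s i)) :=
    exact_of_mapFamily_eq_kerFamily (φ := LinearMap.id) Function.injective_id (hs i)
      ((hcover (s (i + 1))).map_eq.trans (hker (s i)))
  have minimal (i x a) : constantCoeff (cover (s i) x a) = 0 := by
    cases i with
    | zero => exact hf.minimal _ (exact_zero.apply_apply_eq_zero x) a
    | succ i => exact (hcover (s i)).minimal _ ((exact_succ i).apply_apply_eq_zero x) a
  exact ⟨{
    rank := fun i => (s i).rank
    shift := fun i => (s i).deg
    d := fun i => cover (s i)
    aug := f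
    d_mem := fun i j x hx => mem_freeComponent.2 (hs i j x (mem_freeComponent.1 hx))
    aug_mem := fun j x hx => hfI j x (mem_freeComponent.1 hx)
    aug_surjective := surjective_of_mapFamily_eq_idealFamily hI hf.map_eq
    exact_zero := exact_zero
    exact_succ := exact_succ
    minimal := minimal }⟩

end Existence

section Regularity

variable {K : Type u} {V : Type v} [Field K]

section

variable {M : Type*} [AddCommGroup M] [Module (MvPolynomial V K) M] [Module K M]
  {ℳ : ℤ → Submodule K M}

theorem gradedRegularity_le_iff {x : EReal} : gradedRegularity K V M ℳ ≤ x ↔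
    ∀ (F : MinimalGradedFreeResolution K V M ℳ) (i : ℕ) (a : Fin (F.rank i)),
      (((F.shift i a - (i : ℤ) : ℤ) : ℝ) : EReal) ≤ x := by
  simp only [gradedRegularity, iSup_le_iff, MinimalGradedFreeResolution.betti,
    ← pos_iff_ne_zero, Fintype.card_pos_iff, nonempty_subtype, forall_exists_index,
    forall_apply_eq_imp_iff]

theorem gradedRegularity_le_intCast_iff {r : ℤ} : gradedRegularity K V M ℳ ≤ ((r : ℝ) : EReal) ↔
    ∀ (F : MinimalGradedFreeResolution K V M ℳ) (i : ℕ) (a : Fin (F.rank i)),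
      F.shift i a ≤ r + i := by
  simp only [gradedRegularity_le_iff, EReal.coe_le_coe_iff, Int.cast_le, sub_le_iff_le_add]

theorem gradedRegularity_le_of_lt {r : ℤ}
    (h : gradedRegularity K V M ℳ < (((r + 1 : ℤ) : ℝ) : EReal)) :
    gradedRegularity K V M ℳ ≤ ((r : ℝ) : EReal) := by
  refine gradedRegularity_le_iff.2 fun F i a => ?_
  have := (gradedRegularity_le_iff.1 le_rfl F i a).trans_lt h
  rw [EReal.coe_lt_coe_iff, Int.cast_lt, Int.lt_add_one_iff] at this
  exact_mod_cast this

theorem gradedRegularity_le_sub_of_add_lt {r : ℤ} {d : ℕ}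
    (h : gradedRegularity K V M ℳ + (d : EReal) < (((r + 1 : ℤ) : ℝ) : EReal)) :
    gradedRegularity K V M ℳ ≤ (((r - d : ℤ) : ℝ) : EReal) := by
  refine gradedRegularity_le_of_lt ?_
  have hd : (((r - d + 1 : ℤ) : ℝ) : EReal) = (((r + 1 : ℤ) : ℝ) : EReal) - (d : EReal) := by
    rw [← EReal.coe_natCast, ← EReal.coe_sub, sub_add_eq_add_sub]
    push_cast
    rfl
  rw [hd]
  exact (EReal.lt_sub_iff_add_lt (.inl (EReal.natCast_ne_bot d))
    (.inl (EReal.natCast_ne_top d))).2 h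

theorem gradedRegularity_le_of_forall_int {x : EReal}
    (h : ∀ r : ℤ, x < (((r + 1 : ℤ) : ℝ) : EReal) → gradedRegularity K V M ℳ ≤ ((r : ℝ) : EReal)) :
    gradedRegularity K V M ℳ ≤ x := by
  refine gradedRegularity_le_iff.2 fun F i a => le_of_not_gt fun hlt => ?_
  have hr := h (F.shift i a - i - 1) (by rwa [sub_add_cancel])
  have := gradedRegularity_le_intCast_iff.1 hr F i a
  lia

end

theorem idealRegularity_le_iff_regLE [Finite V] {U : Set (V →₀ ℕ)} (hU : IsUpperSet U) {r : ℤ} :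
    idealRegularity (restrictSupportIdeal K U hU) ≤ ((r : ℝ) : EReal) ↔ RegLE K r U := by
  rw [idealRegularity, gradedRegularity_le_intCast_iff, regLE_iff_resolved_idealFamily hU]
  refine ⟨fun h n => ?_, fun h F => F.shift_le_of_resolved h⟩
  have hcomp : ∀ p ∈ restrictSupportIdeal K U hU, ∀ n,
      homogeneousComponent n p ∈ restrictSupportIdeal K U hU := fun p hp n => by
    simp only [mem_restrictSupportIdeal, coeff_homogeneousComponent, ite_ne_right_iff] at hp ⊢
    exact fun a ha => hp a ha.2
  obtain ⟨F⟩ := nonempty_minimalGradedFreeResolution hcomp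
  exact F.resolved_of_shift_le (h F) n

end Regularity

section MonomialIdeals

variable {K : Type u} {V : Type v} [Field K]

theorem span_monomial_eq_restrictSupportIdeal (T : Set (V →₀ ℕ)) :
    Ideal.span ((fun m => monomial m (1 : K)) '' T) =
      restrictSupportIdeal K ↑(upperClosure T) (upperClosure T).upper := by
  ext p
  simp only [mem_ideal_span_monomial_image, mem_restrictSupportIdeal, mem_support_iff,
    SetLike.mem_coe, mem_upperClosure]

theorem restrictSupportIdeal_eq_span {U : Set (V →₀ ℕ)} (hU : IsUpperSet U) :
    restrictSupportIdeal K U hU = Ideal.span ((fun m => monomial m (1 : K)) '' U) := by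
  simp only [span_monomial_eq_restrictSupportIdeal, hU.upperClosure]

theorem restrictSupportIdeal_sup {U W : Set (V →₀ ℕ)} (hU : IsUpperSet U) (hW : IsUpperSet W) :
    restrictSupportIdeal K U hU ⊔ restrictSupportIdeal K W hW =
      restrictSupportIdeal K (U ∪ W) (hU.union hW) := by
  simp only [restrictSupportIdeal_eq_span, Set.image_union, Ideal.span_union]

end MonomialIdeals

section EdgeIdeal

variable {K : Type u} {V : Type v} [Field K] {G : SimpleGraph V}

theorem edgeIdeal_pow_eq_span (s : ℕ) : edgeIdeal K G ^ s =
    Ideal.span ((fun m => monomial m (1 : K)) '' edgeProducts G s) := by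
  induction s with
  | zero =>
    rw [pow_zero, Ideal.one_eq_top, eq_comm, Ideal.eq_top_iff_one]
    exact Ideal.subset_span ⟨0, ⟨0, rfl, by simp, rfl⟩, rfl⟩
  | succ s ih =>
    rw [pow_succ, ih, edgeIdeal, Ideal.span_mul_span']
    congr 1
    ext f
    constructor
    · rintro ⟨_, ⟨_, ⟨l, rfl, hl, rfl⟩, rfl⟩, _, ⟨v, w, h, rfl⟩, rfl⟩
      refine ⟨_, ⟨(v, w) ::ₘ l, Multiset.card_cons _ _, Multiset.forall_mem_cons.2 ⟨h, hl⟩, rfl⟩,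
        ?_⟩
      simp [edgeSum_cons, X, monomial_mul, add_comm]
    · rintro ⟨_, ⟨l, hc, hl, rfl⟩, rfl⟩
      obtain ⟨⟨v, w⟩, l', rfl, hc'⟩ := Multiset.card_eq_succ_iff.1 hc
      obtain ⟨h, hl'⟩ := Multiset.forall_mem_cons.1 hl
      refine ⟨_, ⟨_, ⟨l', hc', hl', rfl⟩, rfl⟩, _, ⟨v, w, h, rfl⟩, ?_⟩
      simp [edgeSum_cons, X, monomial_mul, add_comm]

theorem edgeIdeal_pow_eq_restrictSupportIdeal (s : ℕ) : edgeIdeal K G ^ s =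
    restrictSupportIdeal K ↑(upperClosure (edgeProducts G s))
      (upperClosure (edgeProducts G s)).upper := by
  rw [edgeIdeal_pow_eq_span, span_monomial_eq_restrictSupportIdeal]

theorem isUpperSet_edgeExponents : IsUpperSet (edgeExponents G) := by
  rw [edgeExponents_eq_upperClosure]
  exact (upperClosure (edgeProducts G 1)).upper

theorem edgeIdeal_eq_restrictSupportIdeal :
    edgeIdeal K G = restrictSupportIdeal K (edgeExponents G) isUpperSet_edgeExponents := by
  rw [← pow_one (edgeIdeal K G)]
  simp only [edgeIdeal_pow_eq_restrictSupportIdeal, edgeExponents_eq_upperClosure]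

theorem X_mul_X_mem_edgeIdeal {v w : V} (h : G.Adj v w) : X v * X w ∈ edgeIdeal K G :=
  Ideal.subset_span ⟨v, w, h, rfl⟩

theorem edgeIdeal_le_iff {q : Ideal (MvPolynomial V K)} :
    edgeIdeal K G ≤ q ↔ ∀ v w, G.Adj v w → X v * X w ∈ q := by
  rw [edgeIdeal, Ideal.span_le]
  exact ⟨fun h v w hvw => h ⟨v, w, hvw, rfl⟩, fun h f ⟨v, w, hvw, hf⟩ => hf ▸ h v w hvw⟩

end EdgeIdeal

section CoverIdeal

variable {K : Type u} {V : Type v} [Field K] {C : Finset V}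

open Classical in
/-- The order of vanishing of a polynomial along the linear subspace on which the variables in `C`
vanish. -/
noncomputable def coverOrder (C : Finset V) (f : MvPolynomial V K) : ℕ∞ :=
  (f : MvPowerSeries V K).weightedOrder fun v => if v ∈ C then 1 else 0

theorem le_coverOrder_iff {t : ℕ} {f : MvPolynomial V K} :
    t ≤ coverOrder C f ↔ ∀ a, coeff a f ≠ 0 → t ≤ ∑ v ∈ C, a v := by
  classical
  have hweight (a : V →₀ ℕ) :
      Finsupp.weight (fun v => if v ∈ C then 1 else 0) a = ∑ v ∈ C, a v := by
    simp only [Finsupp.weight_apply, Finsupp.sum, smul_eq_mul, mul_ite, mul_one, mul_zero,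
      Finset.sum_ite_mem]
    exact Finset.sum_subset Finset.inter_subset_right fun v hv hva =>
      Finsupp.notMem_support_iff.1 fun h => hva (Finset.mem_inter.2 ⟨h, hv⟩)
  simp_rw [← hweight]
  refine ⟨fun h a ha => ?_, fun h => MvPowerSeries.nat_le_weightedOrder _ fun a ha => ?_⟩
  · exact_mod_cast h.trans (MvPowerSeries.weightedOrder_le _ (by rwa [coeff_coe]))
  · rw [coeff_coe]
    exact of_not_not fun hne => ha.not_ge (h a hne)

theorem coverOrder_mul (f g : MvPolynomial V K) :
    coverOrder C (f * g) = coverOrder C f + coverOrder C g := by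
  rw [coverOrder, coe_mul, MvPowerSeries.weightedOrder_mul]
  rfl

/-- The ideal generated by the variables in `C`. -/
noncomputable def coverIdeal (K : Type u) [Field K] (C : Finset V) : Ideal (MvPolynomial V K) :=
  Ideal.span (X '' ↑C)

theorem mem_coverIdeal_iff {f : MvPolynomial V K} : f ∈ coverIdeal K C ↔ coverOrder C f ≠ 0 := by
  rw [coverIdeal, mem_ideal_span_X_image, ← Order.one_le_iff_ne_zero, ← Nat.cast_one,
    le_coverOrder_iff]
  simp only [mem_support_iff, Nat.succ_le_iff, sum_pos_iff, Finsupp.mem_support_iff, Finset.mem_coe,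
    and_comm]

instance isPrime_coverIdeal (C : Finset V) : (coverIdeal K C).IsPrime := by
  refine Ideal.isPrime_iff.2 ⟨?_, fun {f g} h => ?_⟩
  · rw [Ne, Ideal.eq_top_iff_one, mem_coverIdeal_iff, not_not, coverOrder, coe_one,
      MvPowerSeries.weightedOrder_one]
  · simp only [mem_coverIdeal_iff, coverOrder_mul] at h ⊢
    contrapose! h
    simp [h]

theorem X_mem_coverIdeal_iff {v : V} : X v ∈ coverIdeal K C ↔ v ∈ C := by
  classical
  simp [coverIdeal, mem_ideal_span_X_image, support_X, Finsupp.single_apply]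

theorem coverIdeal_le_iff {q : Ideal (MvPolynomial V K)} :
    coverIdeal K C ≤ q ↔ ∀ v ∈ C, X v ∈ q :=
  Ideal.span_le.trans Set.image_subset_iff

theorem mem_coverIdeal_pow {t : ℕ} {f : MvPolynomial V K} (h : t ≤ coverOrder C f) :
    f ∈ coverIdeal K C ^ t := by
  classical
  rw [f.as_sum]
  refine sum_mem fun a ha => ?_
  have hdvd : ∏ v ∈ C, X v ^ a v ∣ monomial a (coeff a f) := by
    simp_rw [X_pow_eq_monomial, ← monomial_sum_one, monomial_dvd_monomial, one_dvd, and_true]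
    refine Or.inr (Finsupp.le_def.2 fun v => ?_)
    simp only [Finsupp.finsetSum_apply, Finsupp.single_apply, Finset.sum_ite_eq']
    split_ifs <;> simp
  have hprod : ∏ v ∈ C, X v ^ a v ∈ coverIdeal K C ^ ∑ v ∈ C, a v := by
    rw [← Finset.prod_pow_eq_pow_sum]
    exact Ideal.prod_mem_prod fun v hv => Ideal.pow_mem_pow (X_mem_coverIdeal_iff.2 hv) _
  exact Ideal.mem_of_dvd _ hdvd
    (Ideal.pow_le_pow_right (le_coverOrder_iff.1 h a (mem_support_iff.1 ha)) hprod)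

variable {G : SimpleGraph V}

theorem edgeIdeal_le_coverIdeal (hC : G.IsVertexCover ↑C) : edgeIdeal K G ≤ coverIdeal K C :=
  edgeIdeal_le_iff.2 fun _ _ h => (hC h).elim
    (fun hv => Ideal.mul_mem_right _ _ (X_mem_coverIdeal_iff.2 hv))
    (fun hw => Ideal.mul_mem_left _ _ (X_mem_coverIdeal_iff.2 hw))

theorem mem_minimalPrimes_edgeIdeal_iff [Finite V] {p : Ideal (MvPolynomial V K)} :
    p ∈ (edgeIdeal K G).minimalPrimes ↔ ∃ C, IsMinimalCover G C ∧ p = coverIdeal K C := by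
  classical
  cases nonempty_fintype V
  let D (q : Ideal (MvPolynomial V K)) : Finset V := {v | X v ∈ q}
  have mem_D {q v} : v ∈ D q ↔ X v ∈ q := by simp [D]
  have isVertexCover_D (q : Ideal (MvPolynomial V K)) (hq : q.IsPrime ∧ edgeIdeal K G ≤ q) :
      G.IsVertexCover ↑(D q) := fun v w h => by
    rw [Finset.mem_coe, Finset.mem_coe, mem_D, mem_D]
    exact hq.1.mem_or_mem (edgeIdeal_le_iff.1 hq.2 v w h)
  constructor
  · rintro ⟨hp, hmin⟩
    obtain ⟨C, hCD, hC⟩ := exists_isMinimalCover_subset (isVertexCover_D p hp)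
    have hCp : coverIdeal K C ≤ p := coverIdeal_le_iff.2 fun v hv => mem_D.1 (hCD hv)
    exact ⟨C, hC, le_antisymm (hmin ⟨inferInstance, edgeIdeal_le_coverIdeal hC.1⟩ hCp) hCp⟩
  · rintro ⟨C, hC, rfl⟩
    refine ⟨⟨inferInstance, edgeIdeal_le_coverIdeal hC.1⟩, fun q hq hqC => ?_⟩
    have hDC : D q ≤ C := fun v hv => X_mem_coverIdeal_iff.1 (hqC (mem_D.1 hv))
    exact coverIdeal_le_iff.2 fun v hv => mem_D.1 (hC.2 (isVertexCover_D q hq) hDC hv)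

theorem IsMinimalCover.exists_adj (hC : IsMinimalCover G C) {v : V} (hv : v ∈ C) :
    ∃ w, G.Adj v w ∧ w ∉ C := by
  classical
  by_contra! h
  have hcover : G.IsVertexCover ↑(C.erase v) := fun x y hxy => by
    have := hC.1 hxy
    have := hxy.ne
    have := hxy.symm
    grind
  exact Finset.notMem_erase v C (hC.2 hcover (Finset.erase_subset v C) hv)

theorem le_coverOrder_of_mem_edgeIdeal_pow (hC : G.IsVertexCover ↑C) {t : ℕ}
    {f : MvPolynomial V K} (hf : f ∈ edgeIdeal K G ^ t) : t ≤ coverOrder C f := by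
  classical
  rw [edgeIdeal_pow_eq_restrictSupportIdeal, mem_restrictSupportIdeal] at hf
  refine le_coverOrder_iff.2 fun a ha => ?_
  obtain ⟨_, ⟨l, rfl, hl, rfl⟩, hla⟩ := hf a ha
  calc
    l.card ≤ ∑ v ∈ C, edgeSum l v := by
      rw [sum_edgeSum hC hl]
      exact Nat.le_add_right _ _
    _ ≤ ∑ v ∈ C, a v := Finset.sum_le_sum fun v _ => hla v

theorem IsMinimalCover.exists_span_mul_coverIdeal_le (hC : IsMinimalCover G C) :
    ∃ u ∉ coverIdeal K C, Ideal.span {u} * coverIdeal K C ≤ edgeIdeal K G := by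
  choose! w hw hwC using fun v (hv : v ∈ C) => hC.exists_adj hv
  refine ⟨∏ v ∈ C, X (w v), fun hu => ?_, ?_⟩
  · obtain ⟨v, hv, hvw⟩ := (isPrime_coverIdeal C).prod_mem_iff.1 hu
    exact hwC v hv (X_mem_coverIdeal_iff.1 hvw)
  · rw [coverIdeal, Ideal.span_mul_span', Ideal.span_le]
    rintro _ ⟨_, rfl, _, ⟨v, hv, rfl⟩, rfl⟩
    have hdvd : X v * X (w v) ∣ (∏ v ∈ C, X (w v) : MvPolynomial V K) * X v := by
      rw [mul_comm]
      exact mul_dvd_mul_right (Finset.dvd_prod_of_mem (fun v => X (w v)) hv) _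
    exact Ideal.mem_of_dvd _ hdvd (X_mul_X_mem_edgeIdeal (hw v hv))

theorem exists_mul_mem_edgeIdeal_pow_iff (hC : IsMinimalCover G C) {t : ℕ}
    {f : MvPolynomial V K} :
    (∃ u ∉ coverIdeal K C, u * f ∈ edgeIdeal K G ^ t) ↔ t ≤ coverOrder C f := by
  constructor
  · rintro ⟨u, hu, huf⟩
    have := le_coverOrder_of_mem_edgeIdeal_pow hC.1 huf
    rwa [coverOrder_mul, not_not.1 (mem_coverIdeal_iff.not.1 hu), zero_add] at this
  · intro h
    obtain ⟨u, hu, hle⟩ := hC.exists_span_mul_coverIdeal_le (K := K)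
    refine ⟨u ^ t, fun hut => hu ((isPrime_coverIdeal C).mem_of_pow_mem t hut), ?_⟩
    refine Ideal.pow_right_mono hle t ?_
    rw [mul_pow, Ideal.span_singleton_pow]
    exact Ideal.mul_mem_mul (Ideal.mem_span_singleton_self _) (mem_coverIdeal_pow h)

theorem mem_symbolicPower_iff {R : Type*} [CommRing R] {I : Ideal R} {s : ℕ} {f : R} :
    f ∈ symbolicPower I s ↔ ∀ p ∈ I.minimalPrimes, ∃ u ∉ p, u * f ∈ I ^ s := by
  simp only [symbolicPower, Submodule.mem_iInf, LinearMap.ker_comp, Submodule.mem_comap,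
    LocalizedModule.mem_ker_mkLinearMap_iff, Submodule.mkQ_apply,
    ← Submodule.Quotient.mk_smul, Submodule.Quotient.mk_eq_zero, smul_eq_mul,
    Ideal.mem_primeCompl_iff]

theorem symbolicPower_edgeIdeal [Finite V] (t : ℕ) :
    symbolicPower (edgeIdeal K G) t =
      restrictSupportIdeal K (symbolicExponents G t) (isUpperSet_symbolicExponents t) := by
  ext f
  rw [mem_symbolicPower_iff, mem_restrictSupportIdeal]
  constructor
  · intro h a ha C hC
    have := h _ (mem_minimalPrimes_edgeIdeal_iff.2 ⟨C, hC, rfl⟩)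
    exact le_coverOrder_iff.1 ((exists_mul_mem_edgeIdeal_pow_iff hC).1 this) a ha
  · intro h p hp
    obtain ⟨C, hC, rfl⟩ := mem_minimalPrimes_edgeIdeal_iff.1 hp
    exact (exists_mul_mem_edgeIdeal_pow_iff hC).2 (le_coverOrder_iff.2 fun a ha => h a ha C hC)

end CoverIdeal

theorem symbolicExponents_eq_empty {V : Type*} {G : SimpleGraph V} (hG : ∀ v w, ¬G.Adj v w) {t : ℕ}
    (ht : t ≠ 0) : symbolicExponents G t = ∅ := by
  refine Set.eq_empty_of_forall_notMem fun a ha => ht ?_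
  have hcover : IsMinimalCover G ∅ :=
    ⟨fun v w h => absurd h (hG v w), fun _ _ _ => Finset.empty_subset _⟩
  simpa using ha ∅ hcover

theorem theorem3p6 (K : Type*) [Field K] {V : Type*} [Finite V] (G : SimpleGraph V)
    (s : ℕ) (hs : 1 ≤ s) :
    idealRegularity (symbolicPower (edgeIdeal K G) (s + 1)) ≤
      max (idealRegularity (edgeIdeal K G) + ((2 * s : ℕ) : EReal))
        (idealRegularity (symbolicPower (edgeIdeal K G) (s + 1) ⊔ edgeIdeal K G ^ s)) := by
  rw [symbolicPower_edgeIdeal, edgeIdeal_pow_eq_restrictSupportIdeal, restrictSupportIdeal_sup,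
    edgeIdeal_eq_restrictSupportIdeal]
  refine gradedRegularity_le_of_forall_int fun r hr => (idealRegularity_le_iff_regLE _).2 ?_
  obtain ⟨hI, hJ⟩ := max_lt_iff.1 hr
  have hedge : RegLE K (r - (2 * s : ℕ)) (edgeExponents G) :=
    (idealRegularity_le_iff_regLE _).1 (gradedRegularity_le_sub_of_add_lt hI)
  have hsup := (idealRegularity_le_iff_regLE _).1 (gradedRegularity_le_of_lt hJ)
  by_cases hG : ∃ v w, G.Adj v w
  · obtain ⟨v, w, h⟩ := hG
    exact regLE_symbolicExponents (two_le_of_regLE_edgeExponents h hedge) (by lia) hedge hsup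
  · push Not at hG
    rw [symbolicExponents_eq_empty hG s.succ_ne_zero]
    exact RegLE.empty
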